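/- Let $n\ge 1$ and $a=(a_k)_{k=1}^n\in\mathbb R^n$ with $\sum_k a_k^2=1$. Let $J_\nu$ be the Bessel functions of the first kind, $j_1(x)=2J_1(x)/x$, and read $\frac{\sin x}{x}$ and $j_1(x)$ as $1$ at $x=0$. For $k\in\{1,\dots,n\}$ put $$D_k^{\mathbb R}(a)=\frac2\pi\int_0^\infty\prod_{j\ne k}\frac{\sin(a_js)}{a_js}\,\cos(a_ks)\,ds,\qquad D_k^{\mathbb C}(a)=\frac12\int_0^\infty\prod_{j\ne k}j_1(a_js)\,J_0(a_ks)\,s\,ds ,$$ where $\int_0^\infty=\lim_{T\to\infty}\int_0^T$ is an improper integral, and $D_k^{\mathbb R}(a)$, $D_k^{\mathbb C}(a)$ are read as $0$ if $a_j=0$ for all $j\neq k$ (i.e. $a=\pm e_k$), when the integral oscillates without converging. Let $$A_{n-1}(a)=\mathrm{vol}_{n-1}\{x\in[-\tfrac12,\tfrac12]^n:\langle x,a\rangle=0\},\qquad A_{2(n-1)}(a)=\mathrm{vol}_{2(n-1)}\{x\in\mathbb C^n:\max_k|x_k|\le\tfrac1{\sqrt\pi},\ \langle x,a\rangle=0\},$$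 with $\mathbb C^n$ identified with $\mathbb R^{2n}$. Then all these improper integrals, except those of index $k$ with $a=\pm e_k$, converge, and $$\sum_{k=1}^nD_k^{\mathbb R}(a)=(n-1)\,A_{n-1}(a),\qquad \sum_{k=1}^nD_k^{\mathbb C}(a)=(n-1)\,A_{2(n-1)}(a).$$ -/

import Mathlib

open MeasureTheory Filter Topology

/-- The cube (polydisc for `𝕜 = ℂ`) `{x ∈ 𝕜ⁿ | max_i |x_i| ≤ α}` in Euclidean `𝕜ⁿ`. -/
def cube (𝕜 : Type*) [RCLike 𝕜] (n : ℕ) (α : ℝ) : Set (EuclideanSpace 𝕜 (Fin n)) :=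
  {x | ∀ i, ‖x i‖ ≤ α}

/-- `vol_{n-1}(B ∩ a^⊥)` for the real cube `B = [-1/2, 1/2]ⁿ` of volume one.
`μHE[d]` is the `d`-dimensional Hausdorff measure normalised to agree with Lebesgue measure. -/
noncomputable def sectionReal {n : ℕ} (a : EuclideanSpace ℝ (Fin n)) : ℝ :=
  (μHE[n - 1] : Measure (EuclideanSpace ℝ (Fin n))).real
    (cube ℝ n (1 / 2) ∩ ((Submodule.span ℝ {a})ᗮ : Set (EuclideanSpace ℝ (Fin n))))

/-- `vol_{2(n-1)}(B ∩ a^⊥)` for the polydisc `B ⊆ ℂⁿ = ℝ²ⁿ` of volume one, with discs of radius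
`1/√π`, and the complex hyperplane `a^⊥`. -/
noncomputable def sectionComplex {n : ℕ} (a : EuclideanSpace ℂ (Fin n)) : ℝ :=
  (μHE[2 * (n - 1)] : Measure (EuclideanSpace ℂ (Fin n))).real
    (cube ℂ n (1 / Real.sqrt Real.pi) ∩
      ((Submodule.span ℂ {a})ᗮ : Set (EuclideanSpace ℂ (Fin n))))

/-- A real vector, seen in `ℂⁿ`. -/
noncomputable def toComplex {n : ℕ} (a : EuclideanSpace ℝ (Fin n)) : EuclideanSpace ℂ (Fin n) :=
  WithLp.toLp 2 (fun k => (a k : ℂ))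

/-- The Bessel function `J_ν` of the first kind of integer order `ν ≥ 0` on the real line,
`J_ν(x) = (1/π) ∫_0^π cos(νθ - x sin θ) dθ`. -/
noncomputable def besselJ (ν : ℕ) (x : ℝ) : ℝ :=
  1 / Real.pi * ∫ θ in (0 : ℝ)..Real.pi, Real.cos (ν * θ - x * Real.sin θ)

/-- `j_1(x) = 2 J_1(x) / x`, with `j_1(0) = 1`. -/
noncomputable def besselj1 (x : ℝ) : ℝ :=
  if x = 0 then 1 else 2 * besselJ 1 x / x

/-- The integrand `∏_{j ≠ k} (sin(a_j s) / (a_j s)) · cos(a_k s)`. -/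
noncomputable def integrandReal {n : ℕ} (a : EuclideanSpace ℝ (Fin n)) (k : Fin n) (s : ℝ) : ℝ :=
  (∏ j ∈ Finset.univ.erase k, Real.sinc (a j * s)) * Real.cos (a k * s)

/-- The integrand `∏_{j ≠ k} j_1(a_j s) · J_0(a_k s) · s`. -/
noncomputable def integrandComplex {n : ℕ} (a : EuclideanSpace ℝ (Fin n)) (k : Fin n) (s : ℝ) :
    ℝ :=
  (∏ j ∈ Finset.univ.erase k, besselj1 (a j * s)) * besselJ 0 (a k * s) * s

/-- The improper integral `∫_0^∞ f` converges (possibly only conditionally). -/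
def ImproperConverges (f : ℝ → ℝ) : Prop :=
  ∃ L : ℝ, Tendsto (fun T : ℝ => ∫ s in (0 : ℝ)..T, f s) atTop (𝓝 L)

/-- The value `lim_{T → ∞} ∫_0^T f` of a convergent improper integral. -/
noncomputable def improperIntegral (f : ℝ → ℝ) : ℝ :=
  limUnder atTop (fun T : ℝ => ∫ s in (0 : ℝ)..T, f s)

open Classical in
/-- `D_k(a)` in the real case. If all `a_j` with `j ≠ k` vanish, the integral
`∫_0^∞ cos(a_k s) ds` oscillates, and it is read as `0`. -/
noncomputable def DReal {n : ℕ} (a : EuclideanSpace ℝ (Fin n)) (k : Fin n) : ℝ :=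
  if ∃ j, j ≠ k ∧ a j ≠ 0 then 2 / Real.pi * improperIntegral (integrandReal a k) else 0

open Classical in
/-- `D_k(a)` in the complex case. If all `a_j` with `j ≠ k` vanish, the integral
`∫_0^∞ J_0(a_k s) s ds` oscillates, and it is read as `0`. -/
noncomputable def DComplex {n : ℕ} (a : EuclideanSpace ℝ (Fin n)) (k : Fin n) : ℝ :=
  if ∃ j, j ≠ k ∧ a j ≠ 0 then 1 / 2 * improperIntegral (integrandComplex a k) else 0

/-! The pairs (u, v) = (sinc, cos) with d = 0 and (j_1, J_0) with d = 1 both satisfy x u'(x) =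
(d+1)(v(x) - u(x)). This relation is scale invariant, so for P(s) = ∏ u(a_t s) the product rule
gives (s^(d+1) P / (d+1))' = ∑_k s^d v(a_k s) ∏_{j≠k} u(a_j s) - (n-1) s^d P. Integrating
(`IsRadialPair.sum_integral_eq`) turns the sum of the D_k into (n-1) times a constant multiple of ∫
s^d P, plus a boundary term. Since u decays like x^(-(d+2)/2), the boundary term vanishes at
infinity once two of the a_j are nonzero.

What remains is Ball's formula and its complex analogue (`sectionReal_eq`, `sectionComplex_eq`). The
volume of the slice ⟨x,a⟩ = t of the cube has a Fourier transform that factors over the coordinates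
into transforms of an interval or a disc, which gives P(κ‖w‖). Inversion at t = 0 and polar
coordinates recover the central section.

If two a_j with j ≠ k are nonzero, the k-th integral converges absolutely. If only one is, u(as)
v(bs) s^d is, up to O(s⁻²), the derivative of a function with a limit. The vectors ±e_i are treated
directly: the section has volume one, and the n-1 remaining integrals are the Dirichlet integral or
∫ j_1(s) s ds. -/

/-! ### Bessel functions: integral formulas, derivatives, decay -/

/-- Differentiation under the integral sign for `∫ g θ cos (x sin θ)`. -/
lemma hasDerivAt_integral_mul_cos {g : ℝ → ℝ} (hg : Continuous g) (x : ℝ) :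
    HasDerivAt (fun x : ℝ => ∫ θ in (0 : ℝ)..Real.pi, g θ * Real.cos (x * Real.sin θ))
      (-∫ θ in (0 : ℝ)..Real.pi, g θ * Real.sin θ * Real.sin (x * Real.sin θ)) x := by
  have h := intervalIntegral.hasDerivAt_integral_of_dominated_loc_of_deriv_le
    (μ := volume) (a := 0) (b := Real.pi) (s := Set.univ) (x₀ := x)
    (F := fun x θ => g θ * Real.cos (x * Real.sin θ))
    (F' := fun x θ => -(g θ * Real.sin θ * Real.sin (x * Real.sin θ)))
    (bound := fun θ => |g θ|) Filter.univ_mem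
    (Eventually.of_forall fun y => (by fun_prop : Continuous _).aestronglyMeasurable)
    ((by fun_prop : Continuous _).intervalIntegrable _ _)
    ((by fun_prop : Continuous _).aestronglyMeasurable)
    (Eventually.of_forall fun θ _ y _ => by
      rw [norm_neg, Real.norm_eq_abs, abs_mul, abs_mul]
      calc |g θ| * |Real.sin θ| * |Real.sin (y * Real.sin θ)| ≤ |g θ| * 1 * 1 := by
            gcongr <;> exact Real.abs_sin_le_one _
        _ = |g θ| := by ring)
    ((by fun_prop : Continuous _).intervalIntegrable _ _)
    (Eventually.of_forall fun θ _ y _ => by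
      refine ((((hasDerivAt_id y).mul_const (Real.sin θ)).cos).const_mul (g θ)).congr_deriv ?_
      simp only [id]; ring)
  simpa only [intervalIntegral.integral_neg] using h.2

/-- Differentiation under the integral sign for `∫ g θ sin (x sin θ)`. -/
lemma hasDerivAt_integral_mul_sin {g : ℝ → ℝ} (hg : Continuous g) (x : ℝ) :
    HasDerivAt (fun x : ℝ => ∫ θ in (0 : ℝ)..Real.pi, g θ * Real.sin (x * Real.sin θ))
      (∫ θ in (0 : ℝ)..Real.pi, g θ * Real.sin θ * Real.cos (x * Real.sin θ)) x := by
  have h := intervalIntegral.hasDerivAt_integral_of_dominated_loc_of_deriv_le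
    (μ := volume) (a := 0) (b := Real.pi) (s := Set.univ) (x₀ := x)
    (F := fun x θ => g θ * Real.sin (x * Real.sin θ))
    (F' := fun x θ => g θ * Real.sin θ * Real.cos (x * Real.sin θ))
    (bound := fun θ => |g θ|) Filter.univ_mem
    (Eventually.of_forall fun y => (by fun_prop : Continuous _).aestronglyMeasurable)
    ((by fun_prop : Continuous _).intervalIntegrable _ _)
    ((by fun_prop : Continuous _).aestronglyMeasurable)
    (Eventually.of_forall fun θ _ y _ => by
      rw [Real.norm_eq_abs, abs_mul, abs_mul]
      calc |g θ| * |Real.sin θ| * |Real.cos (y * Real.sin θ)| ≤ |g θ| * 1 * 1 := by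
            gcongr
            · exact Real.abs_sin_le_one _
            · exact Real.abs_cos_le_one _
        _ = |g θ| := by ring)
    ((by fun_prop : Continuous _).intervalIntegrable _ _)
    (Eventually.of_forall fun θ _ y _ => by
      refine ((((hasDerivAt_id y).mul_const (Real.sin θ)).sin).const_mul (g θ)).congr_deriv ?_
      simp only [id]; ring)
  exact h.2

lemma besselJ_zero_eq (x : ℝ) :
    besselJ 0 x = 1 / Real.pi * ∫ θ in (0 : ℝ)..Real.pi, Real.cos (x * Real.sin θ) := by
  simp [besselJ]

lemma besselJ_one_eq (x : ℝ) :
    besselJ 1 x =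
      1 / Real.pi * ∫ θ in (0 : ℝ)..Real.pi, Real.sin θ * Real.sin (x * Real.sin θ) := by
  have h0 : ∫ θ in (0 : ℝ)..Real.pi, Real.cos θ * Real.cos (x * Real.sin θ) = 0 := by
    have := intervalIntegral.integral_comp_sub_left (a := 0) (b := Real.pi)
      (fun θ => Real.cos θ * Real.cos (x * Real.sin θ)) Real.pi
    simp only [Real.cos_pi_sub, Real.sin_pi_sub, sub_self, sub_zero, neg_mul,
      intervalIntegral.integral_neg] at this
    linarith
  have h1 : ∫ θ in (0 : ℝ)..Real.pi, Real.cos ((1 : ℕ) * θ - x * Real.sin θ) =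
      (∫ θ in (0 : ℝ)..Real.pi, Real.cos θ * Real.cos (x * Real.sin θ)) +
        ∫ θ in (0 : ℝ)..Real.pi, Real.sin θ * Real.sin (x * Real.sin θ) := by
    rw [← intervalIntegral.integral_add
      ((by fun_prop : Continuous _).intervalIntegrable _ _)
      ((by fun_prop : Continuous _).intervalIntegrable _ _)]
    simp [Real.cos_sub]
  rw [besselJ, h1, h0, zero_add]

/-- Integration by parts: cos θ sin(x sin θ) vanishes at both ends. The factor x comes out
explicitly, so j_1 gets an integral formula without a singularity at 0. -/
lemma integral_sin_mul_sin_eq (x : ℝ) :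
    ∫ θ in (0 : ℝ)..Real.pi, Real.sin θ * Real.sin (x * Real.sin θ) =
      x * ∫ θ in (0 : ℝ)..Real.pi, Real.cos θ ^ 2 * Real.cos (x * Real.sin θ) := by
  have h := intervalIntegral.integral_eq_sub_of_hasDerivAt (a := 0) (b := Real.pi)
    (f := fun θ => Real.cos θ * Real.sin (x * Real.sin θ))
    (f' := fun θ => x * (Real.cos θ ^ 2 * Real.cos (x * Real.sin θ)) -
      Real.sin θ * Real.sin (x * Real.sin θ))
    (fun θ _ => by
      refine ((Real.hasDerivAt_cos θ).mul
        (((Real.hasDerivAt_sin θ).const_mul x).sin)).congr_deriv ?_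
      ring)
    ((by fun_prop : Continuous _).intervalIntegrable _ _)
  rw [intervalIntegral.integral_sub ((by fun_prop : Continuous _).intervalIntegrable _ _)
      ((by fun_prop : Continuous _).intervalIntegrable _ _),
    intervalIntegral.integral_const_mul] at h
  simp at h
  linarith

lemma besselj1_eq (x : ℝ) :
    besselj1 x =
      2 / Real.pi * ∫ θ in (0 : ℝ)..Real.pi, Real.cos θ ^ 2 * Real.cos (x * Real.sin θ) := by
  rw [besselj1]
  split_ifs with hx
  · subst hx
    simp [integral_cos_sq]
  · rw [besselJ_one_eq, integral_sin_mul_sin_eq]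
    field_simp

lemma mul_besselj1 (x : ℝ) : x * besselj1 x = 2 * besselJ 1 x := by
  rw [besselj1_eq, besselJ_one_eq, integral_sin_mul_sin_eq]
  ring

lemma hasDerivAt_besselJ_zero (x : ℝ) : HasDerivAt (besselJ 0) (-besselJ 1 x) x := by
  have h := (hasDerivAt_integral_mul_cos (g := fun _ => 1) continuous_const x).const_mul
    (1 / Real.pi)
  rw [show besselJ 0 = _ from funext besselJ_zero_eq, besselJ_one_eq]
  simpa using h

/-- This is J_1' = J_0 - J_1/x, with J_1/x written as j_1/2 so that it also holds at 0. It comes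
from sin² = 1 - cos² under the integral. -/
lemma hasDerivAt_besselJ_one (x : ℝ) :
    HasDerivAt (besselJ 1) (besselJ 0 x - besselj1 x / 2) x := by
  have h := (hasDerivAt_integral_mul_sin (g := Real.sin) Real.continuous_sin x).const_mul
    (1 / Real.pi)
  rw [show besselJ 1 = _ from funext besselJ_one_eq, besselJ_zero_eq, besselj1_eq]
  refine h.congr_deriv ?_
  have : ∫ θ in (0 : ℝ)..Real.pi, Real.sin θ * Real.sin θ * Real.cos (x * Real.sin θ) =
      (∫ θ in (0 : ℝ)..Real.pi, Real.cos (x * Real.sin θ)) -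
      ∫ θ in (0 : ℝ)..Real.pi, Real.cos θ ^ 2 * Real.cos (x * Real.sin θ) := by
    rw [← intervalIntegral.integral_sub ((by fun_prop : Continuous _).intervalIntegrable _ _)
      ((by fun_prop : Continuous _).intervalIntegrable _ _)]
    congr 1
    ext θ
    rw [Real.cos_sq']
    ring
  rw [this]
  ring

lemma continuous_besselJ_zero : Continuous (besselJ 0) :=
  continuous_iff_continuousAt.2 fun x => (hasDerivAt_besselJ_zero x).continuousAt

lemma continuous_besselJ_one : Continuous (besselJ 1) :=
  continuous_iff_continuousAt.2 fun x => (hasDerivAt_besselJ_one x).continuousAt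

lemma continuous_besselj1 : Continuous besselj1 := by
  rw [show besselj1 = _ from funext besselj1_eq]
  exact continuous_const.mul (continuous_iff_continuousAt.2 fun x =>
    (hasDerivAt_integral_mul_cos (by fun_prop) x).continuousAt)

lemma besselj1_neg (x : ℝ) : besselj1 (-x) = besselj1 x := by
  simp [besselj1_eq]

lemma besselJ_zero_neg (x : ℝ) : besselJ 0 (-x) = besselJ 0 x := by
  simp [besselJ_zero_eq]

lemma besselJ_one_neg (x : ℝ) : besselJ 1 (-x) = -besselJ 1 x := by
  simp [besselJ_one_eq]

lemma besselJ_zero_zero : besselJ 0 0 = 1 := by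
  simp [besselJ_zero_eq]

lemma besselj1_zero : besselj1 0 = 1 := by simp [besselj1]

lemma abs_besselJ_le_one (ν : ℕ) (x : ℝ) : |besselJ ν x| ≤ 1 := by
  have h := intervalIntegral.norm_integral_le_of_norm_le_const (a := 0) (b := Real.pi) (C := 1)
    (f := fun θ => Real.cos (ν * θ - x * Real.sin θ)) (fun θ _ => Real.abs_cos_le_one _)
  rw [Real.norm_eq_abs, sub_zero, abs_of_pos Real.pi_pos] at h
  rw [besselJ, abs_mul, abs_of_pos (by positivity), one_div, inv_mul_le_iff₀ Real.pi_pos]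
  linarith

lemma abs_besselj1_le_one (x : ℝ) : |besselj1 x| ≤ 1 := by
  have h := intervalIntegral.norm_integral_le_of_norm_le (a := 0) (b := Real.pi) (μ := volume)
    (f := fun θ => Real.cos θ ^ 2 * Real.cos (x * Real.sin θ)) (g := fun θ => Real.cos θ ^ 2)
    Real.pi_pos.le
    (Eventually.of_forall fun θ _ => by
      rw [norm_mul, Real.norm_of_nonneg (sq_nonneg _)]
      exact mul_le_of_le_one_right (sq_nonneg _) (Real.abs_cos_le_one _))
    ((by fun_prop : Continuous _).intervalIntegrable _ _)
  rw [integral_cos_sq, Real.norm_eq_abs] at h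
  simp only [Real.sin_pi, Real.sin_zero, mul_zero, sub_zero, zero_add] at h
  rw [besselj1_eq, abs_mul, abs_of_pos (by positivity), div_mul_eq_mul_div, div_le_one Real.pi_pos]
  linarith

lemma hasDerivAt_besselj1 {x : ℝ} (hx : x ≠ 0) :
    HasDerivAt besselj1 (2 * (besselJ 0 x - besselj1 x) / x) x := by
  have h := ((hasDerivAt_besselJ_one x).const_mul 2).div (hasDerivAt_id x) hx
  have he : besselj1 =ᶠ[𝓝 x] fun y => 2 * besselJ 1 y / y := by
    filter_upwards [isOpen_ne.mem_nhds hx] with y hy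
    simp only [besselj1, if_neg hy]
  refine (h.congr_of_eventuallyEq he).congr_deriv ?_
  have := mul_besselj1 x
  simp only [id]
  rw [show 2 * besselJ 1 x * 1 = x * besselj1 x by linarith]
  field_simp
  ring

/-- The energy of Bessel's equation gives the decay `J_0(x)² + J_1(x)² = O(1/x)`. -/
lemma exists_besselJ_decay :
    ∃ C : ℝ, 0 ≤ C ∧ ∀ x, 0 ≤ x → x * (besselJ 0 x ^ 2 + besselJ 1 x ^ 2) ≤ C := by
  -- The first term has derivative J_0² - J_1². Subtracting J_0 J_1 leaves J_0 J_1 / x, which the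
  -- derivative of the last term cancels, up to the nonpositive -J_0²/(2x²).
  set E : ℝ → ℝ := fun x => x * (besselJ 0 x ^ 2 + besselJ 1 x ^ 2) - besselJ 0 x * besselJ 1 x +
    besselJ 0 x ^ 2 / (2 * x) with hE
  have hd : ∀ x, 0 < x → HasDerivAt E (-(besselJ 0 x ^ 2 / (2 * x ^ 2))) x := by
    intro x hx
    have h0 := hasDerivAt_besselJ_zero x
    have h1 := hasDerivAt_besselJ_one x
    have h := (((hasDerivAt_id x).mul ((h0.pow 2).add (h1.pow 2))).sub (h0.mul h1)).add
      ((h0.pow 2).div ((hasDerivAt_id x).const_mul 2) (by simpa using hx.ne'))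
    refine (h.congr_of_eventuallyEq (Eventually.of_forall fun y => by simp [hE])).congr_deriv ?_
    have h2 : besselj1 x = 2 * besselJ 1 x / x := by simp [besselj1, hx.ne']
    simp [h2]
    field_simp
    ring
  have hanti : AntitoneOn E (Set.Ici 1) := by
    refine antitoneOn_of_deriv_nonpos (convex_Ici 1)
      (fun x hx => (hd x (lt_of_lt_of_le one_pos hx)).continuousAt.continuousWithinAt)
      (fun x hx => ?_) (fun x hx => ?_) <;> rw [interior_Ici] at hx
    · exact (hd x (one_pos.trans hx)).differentiableAt.differentiableWithinAt
    · rw [(hd x (one_pos.trans hx)).deriv]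
      have : 0 ≤ besselJ 0 x ^ 2 / (2 * x ^ 2) := by positivity
      linarith
  refine ⟨max 2 (2 * E 1), by positivity, fun x hx => ?_⟩
  have b0 := abs_le.1 (abs_besselJ_le_one 0 x)
  have b1 := abs_le.1 (abs_besselJ_le_one 1 x)
  rcases le_total x 1 with h | h
  · refine le_trans ?_ (le_max_left _ _)
    have h3 : besselJ 0 x ^ 2 + besselJ 1 x ^ 2 ≤ 2 := by nlinarith
    nlinarith [sq_nonneg (besselJ 0 x), sq_nonneg (besselJ 1 x)]
  · refine le_trans ?_ (le_max_right _ _)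
    have h3 := hanti Set.self_mem_Ici h h
    have h4 : 0 ≤ besselJ 0 x ^ 2 / (2 * x) := by positivity
    have h5 : x * (besselJ 0 x ^ 2 + besselJ 1 x ^ 2) - besselJ 0 x * besselJ 1 x ≤ E x := by
      simp only [hE]; linarith
    -- For x ≥ 1 the cross term J_0 J_1 is at most half of x (J_0² + J_1²); absorbing it costs the
    -- factor 2 in `2 * E 1`.
    nlinarith [sq_nonneg (besselJ 0 x - besselJ 1 x), sq_nonneg (besselJ 0 x),
      sq_nonneg (besselJ 1 x)]

/-! ### Radial pairs: convergence and the summation identity -/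

/-- A continuous function that differs from the derivative of a function with a limit by `O(1/s²)`
has a convergent improper integral. -/
lemma improperConverges_of_hasDerivAt {f G e : ℝ → ℝ} {l C : ℝ} (hf : Continuous f)
    (hG : ∀ s, 1 ≤ s → HasDerivAt G (f s + e s) s) (he : ContinuousOn e (Set.Ici 1))
    (hb : ∀ s, 1 ≤ s → |e s| ≤ C * (s ^ 2)⁻¹) (hl : Tendsto G atTop (𝓝 l)) :
    ImproperConverges f := by
  have hint : IntegrableOn e (Set.Ioi 1) := by
    have h1 : IntegrableOn (fun s : ℝ => C * (s ^ 2)⁻¹) (Set.Ioi 1) := by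
      have := (integrableOn_Ioi_rpow_of_lt (by norm_num : (-2 : ℝ) < -1) one_pos).const_mul C
      refine IntegrableOn.congr_fun this (fun s hs => ?_) measurableSet_Ioi
      have hs0 : (0 : ℝ) ≤ s := (zero_le_one.trans (le_of_lt hs))
      simp only [Real.rpow_neg hs0]
      norm_num
    refine Integrable.mono' h1
      ((he.mono Set.Ioi_subset_Ici_self).aestronglyMeasurable measurableSet_Ioi) ?_
    filter_upwards [ae_restrict_mem measurableSet_Ioi] with s hs using hb s (le_of_lt hs)
  have hte := intervalIntegral_tendsto_integral_Ioi 1 hint tendsto_id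
  refine ⟨(∫ s in (0 : ℝ)..1, f s) + (l - G 1 - ∫ s in Set.Ioi 1, e s), ?_⟩
  refine (tendsto_const_nhds.add ((hl.sub_const (G 1)).sub hte)).congr' ?_
  filter_upwards [eventually_ge_atTop 1] with T hT
  have hec : ContinuousOn e (Set.uIcc 1 T) := by
    rw [Set.uIcc_of_le hT]
    exact he.mono Set.Icc_subset_Ici_self
  have h1 : ∫ s in (1 : ℝ)..T, (f s + e s) = G T - G 1 :=
    intervalIntegral.integral_eq_sub_of_hasDerivAt
      (fun s hs => hG s (by rw [Set.uIcc_of_le hT] at hs; exact hs.1))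
      ((hf.continuousOn.add hec).intervalIntegrable)
  rw [intervalIntegral.integral_add (hf.intervalIntegrable _ _) hec.intervalIntegrable] at h1
  rw [← intervalIntegral.integral_add_adjacent_intervals (hf.intervalIntegrable 0 1)
    (hf.intervalIntegrable 1 T)]
  simp only [id]
  linarith

/-- The functional relations shared by the pairs `(sinc, cos)` (with `d = 0`) and `(j_1, J_0)`
(with `d = 1`). -/
structure IsRadialPair (d : ℕ) (u v : ℝ → ℝ) : Prop where
  continuous_left : Continuous u
  continuous_right : Continuous v
  left_zero : u 0 = 1
  right_zero : v 0 = 1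
  left_neg : ∀ x, u (-x) = u x
  abs_left_le : ∀ x, |u x| ≤ 1
  abs_right_le : ∀ x, |v x| ≤ 1
  hasDerivAt : ∀ x, x ≠ 0 → HasDerivAt u ((d + 1) * (v x - u x) / x) x
  decay : ∃ C, ∀ x, u x ^ 2 * |x| ^ (d + 2) ≤ C
  converges : ∀ a b, a ≠ 0 → ImproperConverges (fun s => u (a * s) * v (b * s) * s ^ d)

/-- The integrand `∏_{j ≠ k} u(a_j s) · v(a_k s) · s^d`. -/
noncomputable def radialIntegrand (d : ℕ) (u v : ℝ → ℝ) {n : ℕ} (a : Fin n → ℝ) (k : Fin n)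
    (s : ℝ) : ℝ :=
  (∏ j ∈ Finset.univ.erase k, u (a j * s)) * v (a k * s) * s ^ d

namespace IsRadialPair

variable {d n : ℕ} {u v : ℝ → ℝ}

/-- The chain-rule factor a cancels against the denominator a s. The formula survives at a = 0
because u and v both equal 1 at 0. -/
lemma hasDerivAt_comp_mul (h : IsRadialPair d u v) (a : ℝ) {s : ℝ} (hs : 0 < s) :
    HasDerivAt (fun s => u (a * s)) ((d + 1) * (v (a * s) - u (a * s)) / s) s := by
  rcases eq_or_ne a 0 with rfl | ha
  · simpa [h.left_zero, h.right_zero] using hasDerivAt_const s (1 : ℝ)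
  · have h1 := (h.hasDerivAt (a * s) (mul_ne_zero ha hs.ne')).comp s
      ((hasDerivAt_id s).const_mul a)
    refine h1.congr_deriv ?_
    field_simp

lemma continuous_radialIntegrand (h : IsRadialPair d u v) (a : Fin n → ℝ) (k : Fin n) :
    Continuous (radialIntegrand d u v a k) := by
  have := h.continuous_left
  have := h.continuous_right
  unfold radialIntegrand
  fun_prop

lemma abs_prod_le_one (h : IsRadialPair d u v) (a : Fin n → ℝ) (S : Finset (Fin n)) (s : ℝ) :
    |∏ t ∈ S, u (a t * s)| ≤ 1 := by
  rw [Finset.abs_prod]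
  exact Finset.prod_le_one (fun _ _ => abs_nonneg _) fun _ _ => h.abs_left_le _

lemma exists_sq_le (h : IsRadialPair d u v) {a : ℝ} (ha : a ≠ 0) :
    ∃ C, ∀ s, 0 < s → u (a * s) ^ 2 ≤ C * (s ^ (d + 2))⁻¹ := by
  obtain ⟨C, hC⟩ := h.decay
  refine ⟨C / |a| ^ (d + 2), fun s hs => ?_⟩
  have h1 := hC (a * s)
  have ha' : 0 < |a| := abs_pos.2 ha
  rw [abs_mul, abs_of_pos hs, mul_pow] at h1
  rw [← div_eq_mul_inv, div_div, le_div_iff₀ (by positivity)]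
  exact h1

/-- The decay bound concerns u², so two nonzero coefficients and 2|xy| ≤ x² + y² give one full power
s^(-(d+2)); the other factors are at most 1. Against s^d this leaves the integrable s⁻², against
T^(d+1) the vanishing 1/T. -/
lemma exists_abs_prod_le (h : IsRadialPair d u v) (a : Fin n → ℝ) {S : Finset (Fin n)}
    {i j : Fin n} (hi : i ∈ S) (hj : j ∈ S) (hij : i ≠ j) (hai : a i ≠ 0) (haj : a j ≠ 0) :
    ∃ C, ∀ s, 0 < s → |∏ t ∈ S, u (a t * s)| ≤ C * (s ^ (d + 2))⁻¹ := by
  obtain ⟨C, hC⟩ := h.exists_sq_le hai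
  obtain ⟨D, hD⟩ := h.exists_sq_le haj
  refine ⟨(C + D) / 2, fun s hs => ?_⟩
  rw [← Finset.mul_prod_erase S _ hi,
    ← Finset.mul_prod_erase (S.erase i) _ (Finset.mem_erase.2 ⟨hij.symm, hj⟩), ← mul_assoc, abs_mul]
  refine (mul_le_of_le_one_right (abs_nonneg _) (h.abs_prod_le_one a _ s)).trans ?_
  have h1 := hC s hs
  have h2 := hD s hs
  rw [abs_mul]
  have h3 := two_mul_le_add_sq |u (a i * s)| |u (a j * s)|
  rw [sq_abs, sq_abs] at h3
  linarith

lemma improperConverges_of_two (h : IsRadialPair d u v) (a : Fin n → ℝ) {k i j : Fin n}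
    (hik : i ≠ k) (hjk : j ≠ k) (hij : i ≠ j) (hai : a i ≠ 0) (haj : a j ≠ 0) :
    ImproperConverges (radialIntegrand d u v a k) := by
  obtain ⟨C, hC⟩ := h.exists_abs_prod_le a (S := Finset.univ.erase k) (i := i) (j := j)
    (by simpa using hik) (by simpa using hjk) hij hai haj
  have hc := h.continuous_radialIntegrand a k
  -- The integrand itself is O(s⁻²), so all of it is put into the error term.
  refine improperConverges_of_hasDerivAt (G := fun _ => 0) (C := C)
    (e := fun s => -radialIntegrand d u v a k s) hc
    (fun s _ => by simpa using hasDerivAt_const s (0 : ℝ)) hc.neg.continuousOn (fun s hs => ?_)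
    tendsto_const_nhds
  have hs0 : 0 < s := one_pos.trans_le hs
  rw [abs_neg, radialIntegrand, abs_mul, abs_mul, abs_of_pos (pow_pos hs0 d)]
  calc _ ≤ (C * (s ^ (d + 2))⁻¹) * 1 * s ^ d := by
        gcongr
        · exact (abs_nonneg _).trans (hC s hs0)
        · exact hC s hs0
        · exact h.abs_right_le _
    _ = C * (s ^ 2)⁻¹ := by rw [pow_add]; field_simp

/-- All the integrals converge, except when all `a_j` with `j ≠ k` vanish. -/
lemma improperConverges (h : IsRadialPair d u v) (a : Fin n → ℝ) {k : Fin n}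
    (hk : ∃ j, j ≠ k ∧ a j ≠ 0) : ImproperConverges (radialIntegrand d u v a k) := by
  obtain ⟨j, hjk, haj⟩ := hk
  by_cases hex : ∃ i, i ≠ k ∧ i ≠ j ∧ a i ≠ 0
  · obtain ⟨i, hik, hij, hai⟩ := hex
    exact h.improperConverges_of_two a hik hjk hij hai haj
  -- Every other factor is u(0) = 1, so only the conditionally convergent u(a_j s) v(a_k s) s^d is
  -- left.
  · push Not at hex
    convert! h.converges (a j) (a k) haj using 2 with s
    rw [radialIntegrand, Finset.prod_eq_single j]
    · intro i hi hij
      rw [hex i (Finset.ne_of_mem_erase hi) hij, zero_mul, h.left_zero]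
    · simp [hjk]

lemma integrableOn_prod (h : IsRadialPair d u v) (a : Fin n → ℝ) {i j : Fin n}
    (hij : i ≠ j) (hai : a i ≠ 0) (haj : a j ≠ 0) :
    IntegrableOn (fun s => s ^ d * ∏ t, u (a t * s)) (Set.Ioi 0) := by
  obtain ⟨C, hC⟩ := h.exists_abs_prod_le a (Finset.mem_univ i) (Finset.mem_univ j) hij hai haj
  have hu := h.continuous_left
  have hc : Continuous fun s => s ^ d * ∏ t, u (a t * s) := by fun_prop
  rw [← Set.Ioc_union_Ioi_eq_Ioi zero_le_one]
  refine (hc.integrableOn_Ioc).union ?_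
  have h1 : IntegrableOn (fun s : ℝ => C * (s ^ 2)⁻¹) (Set.Ioi 1) := by
    have := (integrableOn_Ioi_rpow_of_lt (by norm_num : (-2 : ℝ) < -1) one_pos).const_mul C
    refine IntegrableOn.congr_fun this (fun s hs => ?_) measurableSet_Ioi
    have hs0 : (0 : ℝ) ≤ s := (zero_le_one.trans (le_of_lt hs))
    simp only [Real.rpow_neg hs0]
    norm_num
  refine Integrable.mono' h1 hc.aestronglyMeasurable ?_
  filter_upwards [ae_restrict_mem measurableSet_Ioi] with s hs
  have hs0 : 0 < s := one_pos.trans hs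
  rw [Real.norm_eq_abs, abs_mul, abs_of_pos (pow_pos hs0 d)]
  calc _ ≤ s ^ d * (C * (s ^ (d + 2))⁻¹) := by gcongr; exact hC s hs0
    _ = C * (s ^ 2)⁻¹ := by rw [pow_add]; field_simp

/-- The product rule applied to s^(d+1) ∏ u(a_t s)/(d+1). Differentiating the t-th factor replaces
it by v - u, so the n factors contribute the n integrands and -n copies of the full product;
differentiating s^(d+1) returns one copy. -/
lemma sum_integral_eq (h : IsRadialPair d u v) (a : Fin n → ℝ) {T : ℝ} (hT : 0 ≤ T) :
    ∑ k, ∫ s in (0 : ℝ)..T, radialIntegrand d u v a k s =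
      T ^ (d + 1) * (∏ t, u (a t * T)) / (d + 1) +
        ((n : ℝ) - 1) * ∫ s in (0 : ℝ)..T, s ^ d * ∏ t, u (a t * s) := by
  have hu := h.continuous_left
  have hI := h.continuous_radialIntegrand a
  have hder : ∀ s ∈ Set.Ioo 0 T, HasDerivAt (fun s => s ^ (d + 1) * (∏ t, u (a t * s)) / (d + 1))
      (∑ k, radialIntegrand d u v a k s - ((n : ℝ) - 1) * (s ^ d * ∏ t, u (a t * s))) s := by
    intro s hs
    have hp := HasDerivAt.fun_finsetProd (u := Finset.univ) (f := fun t s => u (a t * s))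
      (f' := fun t => (d + 1) * (v (a t * s) - u (a t * s)) / s) (x := s)
      (fun t _ => h.hasDerivAt_comp_mul (a t) hs.1)
    refine (((hasDerivAt_pow (d + 1) s).mul hp).div_const ((d : ℝ) + 1)).congr_deriv ?_
    have hd : (d : ℝ) + 1 ≠ 0 := by positivity
    have hs0 := hs.1.ne'
    have h2 : ∀ t, (∏ j ∈ Finset.univ.erase t, u (a j * s)) •
        ((d + 1) * (v (a t * s) - u (a t * s)) / s) =
        (d + 1) / s ^ (d + 1) * (radialIntegrand d u v a t s - s ^ d * ∏ j, u (a j * s)) := by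
      intro t
      rw [← Finset.mul_prod_erase Finset.univ _ (Finset.mem_univ t), radialIntegrand, smul_eq_mul]
      generalize ∏ j ∈ Finset.univ.erase t, u (a j * s) = P
      generalize u (a t * s) = U, v (a t * s) = V
      field_simp
      ring
    simp only [h2, ← Finset.mul_sum, Finset.sum_sub_distrib, Finset.sum_const, Finset.card_univ,
      Fintype.card_fin, nsmul_eq_mul]
    push_cast
    field_simp
    ring_nf
  have hftc := intervalIntegral.integral_eq_sub_of_hasDerivAt_of_le hT
    (by fun_prop) hder ((by fun_prop : Continuous _).intervalIntegrable _ _)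
  rw [intervalIntegral.integral_sub ((by fun_prop : Continuous _).intervalIntegrable _ _)
      ((by fun_prop : Continuous _).intervalIntegrable _ _),
    intervalIntegral.integral_const_mul,
    intervalIntegral.integral_finsetSum fun k _ => (hI k).intervalIntegrable _ _] at hftc
  simp only [ne_eq, Nat.add_eq_zero_iff, one_ne_zero, and_false, not_false_eq_true, zero_pow,
    zero_mul, zero_div, sub_zero] at hftc
  linarith

/-- The sum of the improper integrals, if at least two of the `a_j` are nonzero. -/
lemma tendsto_sum_integral (h : IsRadialPair d u v) (a : Fin n → ℝ) {i j : Fin n}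
    (hij : i ≠ j) (hai : a i ≠ 0) (haj : a j ≠ 0) :
    Tendsto (fun T : ℝ => ∑ k, ∫ s in (0 : ℝ)..T, radialIntegrand d u v a k s) atTop
      (𝓝 (((n : ℝ) - 1) * ∫ s in Set.Ioi 0, s ^ d * ∏ t, u (a t * s))) := by
  have h1 := (intervalIntegral_tendsto_integral_Ioi 0
    (h.integrableOn_prod a hij hai haj) tendsto_id).const_mul ((n : ℝ) - 1)
  obtain ⟨C, hC⟩ := h.exists_abs_prod_le a (Finset.mem_univ i) (Finset.mem_univ j) hij hai haj
  have h2 : Tendsto (fun T : ℝ => T ^ (d + 1) * (∏ t, u (a t * T)) / (d + 1)) atTop (𝓝 0) := by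
    have h3 : Tendsto (fun T : ℝ => C * T⁻¹) atTop (𝓝 0) := by
      simpa using tendsto_inv_atTop_zero.const_mul C
    refine squeeze_zero_norm' ?_ h3
    filter_upwards [eventually_gt_atTop 0] with T hT
    have hd : (1 : ℝ) ≤ d + 1 := by simp
    rw [Real.norm_eq_abs, abs_div, abs_of_pos (by positivity : (0 : ℝ) < d + 1)]
    refine (div_le_self (abs_nonneg _) hd).trans ?_
    rw [abs_mul, abs_of_pos (pow_pos hT _)]
    calc _ ≤ T ^ (d + 1) * (C * (T ^ (d + 2))⁻¹) := by gcongr; exact hC T hT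
      _ = C * T⁻¹ := by rw [pow_succ _ (d + 1)]; field_simp
  have h4 := h2.add h1
  rw [zero_add] at h4
  refine h4.congr' ?_
  filter_upwards [eventually_ge_atTop 0] with T hT
  rw [h.sum_integral_eq a hT]
  rfl

end IsRadialPair

lemma ImproperConverges.tendsto {f : ℝ → ℝ} (h : ImproperConverges f) :
    Tendsto (fun T : ℝ => ∫ s in (0 : ℝ)..T, f s) atTop (𝓝 (improperIntegral f)) :=
  tendsto_nhds_limUnder h

lemma IsRadialPair.sum_improperIntegral {d n : ℕ} {u v : ℝ → ℝ} (h : IsRadialPair d u v)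
    (a : Fin n → ℝ) {i j : Fin n} (hij : i ≠ j) (hai : a i ≠ 0) (haj : a j ≠ 0) :
    ∑ k, improperIntegral (radialIntegrand d u v a k) =
      ((n : ℝ) - 1) * ∫ s in Set.Ioi 0, s ^ d * ∏ t, u (a t * s) := by
  refine tendsto_nhds_unique ?_ (h.tendsto_sum_integral a hij hai haj)
  refine tendsto_finsetSum _ fun k _ => (h.improperConverges a ?_).tendsto
  by_cases hik : i = k
  · exact ⟨j, fun hjk => hij (hik.trans hjk.symm), haj⟩
  · exact ⟨i, hik, hai⟩

/-! ### The two radial pairs -/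

/-- The pair `(sinc, cos)`. -/
lemma isRadialPair_sinc_cos : IsRadialPair 0 Real.sinc Real.cos where
  continuous_left := Real.continuous_sinc
  continuous_right := Real.continuous_cos
  left_zero := Real.sinc_zero
  right_zero := Real.cos_zero
  left_neg := Real.sinc_neg
  abs_left_le := Real.abs_sinc_le_one
  abs_right_le := Real.abs_cos_le_one
  hasDerivAt x hx := by
    have h := (Real.hasDerivAt_sin x).div (hasDerivAt_id x) hx
    have he : Real.sinc =ᶠ[𝓝 x] fun y => Real.sin y / y := by
      filter_upwards [isOpen_ne.mem_nhds hx] with y hy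
      exact Real.sinc_of_ne_zero hy
    refine (h.congr_of_eventuallyEq he).congr_deriv ?_
    rw [Real.sinc_of_ne_zero hx]
    simp
    field_simp
  decay := by
    refine ⟨1, fun x => ?_⟩
    rcases eq_or_ne x 0 with rfl | hx
    · simp
    · rw [Real.sinc_of_ne_zero hx, zero_add, sq_abs, div_pow, div_mul_cancel₀ _ (by positivity)]
      exact Real.sin_sq_le_one x
  converges a b ha := by
    -- sin(as) cos(bs) has a bounded antiderivative A, including in the resonant case a² = b², where
    -- it is the derivative of sin²(as)/(2a).
    obtain ⟨A, M, hA, hM⟩ : ∃ (A : ℝ → ℝ) (M : ℝ),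
        (∀ s, HasDerivAt A (Real.sin (a * s) * Real.cos (b * s)) s) ∧ ∀ s, |A s| ≤ M := by
      have hsa : ∀ s : ℝ, HasDerivAt (fun s => Real.sin (a * s)) (Real.cos (a * s) * a) s :=
        fun s => by simpa using ((hasDerivAt_id s).const_mul a).sin
      have hsb : ∀ s : ℝ, HasDerivAt (fun s => Real.sin (b * s)) (Real.cos (b * s) * b) s :=
        fun s => by simpa using ((hasDerivAt_id s).const_mul b).sin
      have hca : ∀ s : ℝ, HasDerivAt (fun s => Real.cos (a * s)) (-Real.sin (a * s) * a) s :=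
        fun s => by simpa using ((hasDerivAt_id s).const_mul a).cos
      have hcb : ∀ s : ℝ, HasDerivAt (fun s => Real.cos (b * s)) (-Real.sin (b * s) * b) s :=
        fun s => by simpa using ((hasDerivAt_id s).const_mul b).cos
      by_cases hab : a ^ 2 = b ^ 2
      · refine ⟨fun s => Real.sin (a * s) ^ 2 / (2 * a), 1 / (2 * |a|), fun s => ?_, fun s => ?_⟩
        · refine (((hsa s).pow 2).div_const (2 * a)).congr_deriv ?_
          have : Real.cos (b * s) = Real.cos (a * s) := by
            rcases sq_eq_sq_iff_eq_or_eq_neg.1 hab with h | h <;> simp [h]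
          rw [this]
          norm_num
          field_simp
        · rw [abs_div, abs_mul, abs_two, abs_of_nonneg (sq_nonneg _)]
          gcongr
          exact Real.sin_sq_le_one _
      · have hne : b ^ 2 - a ^ 2 ≠ 0 := fun h => hab (by linarith)
        refine ⟨fun s => (a * (Real.cos (a * s) * Real.cos (b * s)) +
          b * (Real.sin (a * s) * Real.sin (b * s))) / (b ^ 2 - a ^ 2),
          (|a| + |b|) / |b ^ 2 - a ^ 2|, fun s => ?_, fun s => ?_⟩
        · refine (((((hca s).mul (hcb s)).const_mul a).add
            (((hsa s).mul (hsb s)).const_mul b)).div_const _).congr_deriv ?_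
          field_simp
          ring
        · rw [abs_div]
          gcongr
          refine (abs_add_le _ _).trans ?_
          simp only [abs_mul]
          gcongr
          · exact mul_le_of_le_one_right (abs_nonneg _)
              (mul_le_one₀ (Real.abs_cos_le_one _) (abs_nonneg _) (Real.abs_cos_le_one _))
          · exact mul_le_of_le_one_right (abs_nonneg _)
              (mul_le_one₀ (Real.abs_sin_le_one _) (abs_nonneg _) (Real.abs_sin_le_one _))
    have hAc : Continuous A := continuous_iff_continuousAt.2 fun s => (hA s).continuousAt
    -- Integration by parts against 1/(as): A/(as) tends to 0 and leaves the error A/(as²).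
    refine improperConverges_of_hasDerivAt (l := 0) (C := M / |a|)
      (G := fun s => A s / (a * s)) (e := fun s => -(A s / (a * s ^ 2)))
      (by have := Real.continuous_sinc; fun_prop) (fun s hs => ?_) ?_ (fun s hs => ?_) ?_
    · have hs0 : s ≠ 0 := by positivity
      refine ((hA s).div ((hasDerivAt_id s).const_mul a)
        (mul_ne_zero ha hs0)).congr_deriv ?_
      simp only [id]
      rw [Real.sinc_of_ne_zero (mul_ne_zero ha hs0)]
      field_simp
      ring
    · refine (hAc.continuousOn.div (by fun_prop) fun s hs => ?_).neg
      have : s ≠ 0 := (zero_lt_one.trans_le hs).ne'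
      positivity
    · rw [abs_neg, abs_div, abs_mul, abs_of_nonneg (sq_nonneg s), ← div_eq_mul_inv, div_div]
      gcongr
      exact hM s
    · have h3 : Tendsto (fun s : ℝ => M / |a| * s⁻¹) atTop (𝓝 0) := by
        simpa using tendsto_inv_atTop_zero.const_mul (M / |a|)
      refine squeeze_zero_norm' ?_ h3
      filter_upwards [eventually_gt_atTop 0] with s hs
      rw [Real.norm_eq_abs, abs_div, abs_mul, abs_of_pos hs, ← div_eq_mul_inv, div_div]
      gcongr
      exact hM s

lemma exists_besselJ_sq_le {a : ℝ} (ha : a ≠ 0) :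
    ∃ C, ∀ s, 0 < s → besselJ 0 (a * s) ^ 2 + besselJ 1 (a * s) ^ 2 ≤ C * s⁻¹ := by
  obtain ⟨C, -, hC⟩ := exists_besselJ_decay
  refine ⟨C / |a|, fun s hs => ?_⟩
  have h1 := hC (|a| * s) (by positivity)
  have h2 : besselJ 0 (|a| * s) ^ 2 + besselJ 1 (|a| * s) ^ 2 =
      besselJ 0 (a * s) ^ 2 + besselJ 1 (a * s) ^ 2 := by
    rcases abs_choice a with h | h <;> rw [h]
    rw [neg_mul, besselJ_zero_neg, besselJ_one_neg, neg_sq]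
  have ha' : 0 < |a| := abs_pos.2 ha
  rw [← div_eq_mul_inv, div_div, le_div_iff₀ (by positivity), ← h2]
  linarith

lemma tendsto_zero_of_sq_le {f : ℝ → ℝ} {C : ℝ} (h : ∀ s, 0 < s → f s ^ 2 ≤ C * s⁻¹) :
    Tendsto f atTop (𝓝 0) := by
  have h3 : Tendsto (fun s : ℝ => C * s⁻¹) atTop (𝓝 0) := by
    simpa using tendsto_inv_atTop_zero.const_mul C
  have h4 : Tendsto (fun s => f s ^ 2) atTop (𝓝 0) :=
    squeeze_zero' (Eventually.of_forall fun s => sq_nonneg _)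
      ((eventually_gt_atTop 0).mono h) h3
  have h5 := h4.sqrt
  simp only [Real.sqrt_sq_eq_abs, Real.sqrt_zero] at h5
  exact (tendsto_zero_iff_abs_tendsto_zero _).2 h5

lemma tendsto_besselJ_zero_mul {a : ℝ} (ha : a ≠ 0) :
    Tendsto (fun s => besselJ 0 (a * s)) atTop (𝓝 0) := by
  obtain ⟨C, hC⟩ := exists_besselJ_sq_le ha
  exact tendsto_zero_of_sq_le (C := C) fun s hs => by
    nlinarith [hC s hs, sq_nonneg (besselJ 1 (a * s))]

lemma tendsto_besselJ_one_mul {a : ℝ} (ha : a ≠ 0) :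
    Tendsto (fun s => besselJ 1 (a * s)) atTop (𝓝 0) := by
  obtain ⟨C, hC⟩ := exists_besselJ_sq_le ha
  exact tendsto_zero_of_sq_le (C := C) fun s hs => by
    nlinarith [hC s hs, sq_nonneg (besselJ 0 (a * s))]

/-- The Weber–Schafheitlin integral `∫ J_1(as) J_0(bs) ds` converges. -/
lemma improperConverges_besselJ_one_mul_besselJ_zero {a : ℝ} (b : ℝ) (ha : a ≠ 0) :
    ImproperConverges (fun s => besselJ 1 (a * s) * besselJ 0 (b * s)) := by
  have hc0 := continuous_besselJ_zero
  have hc1 := continuous_besselJ_one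
  have hd0 : ∀ c s : ℝ, HasDerivAt (fun s => besselJ 0 (c * s)) (-besselJ 1 (c * s) * c) s :=
    fun c s =>
      ((hasDerivAt_besselJ_zero (c * s)).comp s ((hasDerivAt_id s).const_mul c)).congr_deriv
        (by simp)
  have hd1 : ∀ c s : ℝ, s ≠ 0 → HasDerivAt (fun s => besselJ 1 (c * s))
      (c * besselJ 0 (c * s) - besselJ 1 (c * s) / s) s :=
    fun c s hs => by
      refine ((hasDerivAt_besselJ_one (c * s)).comp s
        ((hasDerivAt_id s).const_mul c)).congr_deriv ?_
      have := mul_besselj1 (c * s)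
      field_simp
      linear_combination -this
  by_cases hab : a ^ 2 = b ^ 2
  -- In the resonant case J_1(as) J_0(as) is an exact derivative, that of -J_0(as)²/(2a).
  · refine improperConverges_of_hasDerivAt (l := 0) (C := 0) (e := fun _ => 0)
      (G := fun s => -(besselJ 0 (a * s) ^ 2 / (2 * a))) (by fun_prop) (fun s hs => ?_)
      continuousOn_const (fun s hs => by simp) ?_
    · refine ((((hd0 a s).pow 2).div_const (2 * a)).neg).congr_deriv ?_
      have : besselJ 0 (b * s) = besselJ 0 (a * s) := by
        rcases sq_eq_sq_iff_eq_or_eq_neg.1 hab with h | h <;> simp [h, besselJ_zero_neg]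
      rw [this]
      norm_num
      field_simp
    · simpa using (((tendsto_besselJ_zero_mul ha).pow 2).div_const (2 * a)).neg
  · have hne : b ^ 2 - a ^ 2 ≠ 0 := fun h => hab (by linarith)
    obtain ⟨C, hC⟩ := exists_besselJ_sq_le ha
    obtain ⟨D, hD⟩ : ∃ D, ∀ s, 0 < s → besselJ 1 (b * s) ^ 2 ≤ D * s⁻¹ := by
      rcases eq_or_ne b 0 with rfl | hb
      · exact ⟨0, fun s _ => by simp [besselJ_one_eq]⟩
      · obtain ⟨D, hD⟩ := exists_besselJ_sq_le hb
        exact ⟨D, fun s hs => by nlinarith [hD s hs, sq_nonneg (besselJ 0 (b * s))]⟩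
    -- G imitates the antiderivative of sin(as) cos(bs). The -J_1/s in J_1' leaves an error
    -- proportional to J_1(as) J_1(bs)/s, which is O(s⁻²) because each J_1 is O(s^(-1/2)).
    refine improperConverges_of_hasDerivAt (l := 0)
      (C := |2 * b / (b ^ 2 - a ^ 2)| * ((C + D) / 2))
      (e := fun s => -(2 * b / (b ^ 2 - a ^ 2)) * (besselJ 1 (a * s) * besselJ 1 (b * s) / s))
      (G := fun s => (a * (besselJ 0 (a * s) * besselJ 0 (b * s)) +
        b * (besselJ 1 (a * s) * besselJ 1 (b * s))) / (b ^ 2 - a ^ 2)) (by fun_prop)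
      (fun s hs => ?_) ?_ (fun s hs => ?_) ?_
    · have hs0 : s ≠ 0 := by positivity
      refine (((((hd0 a s).mul (hd0 b s)).const_mul a).add
        (((hd1 a s hs0).mul (hd1 b s hs0)).const_mul b)).div_const _).congr_deriv ?_
      field_simp
      ring
    · refine continuousOn_const.mul (ContinuousOn.div (by fun_prop) continuousOn_id fun s hs => ?_)
      exact (zero_lt_one.trans_le hs).ne'
    · have hs0 : 0 < s := by positivity
      rw [abs_mul, abs_neg, mul_assoc]
      gcongr
      rw [abs_div, abs_mul, abs_of_pos hs0, div_le_iff₀ hs0]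
      have h3 := two_mul_le_add_sq |besselJ 1 (a * s)| |besselJ 1 (b * s)|
      rw [sq_abs, sq_abs] at h3
      have h4 := hC s hs0
      have h5 := hD s hs0
      have h6 : (C + D) / 2 * (s ^ 2)⁻¹ * s = (C * s⁻¹ + D * s⁻¹) / 2 := by
        field_simp
      rw [h6]
      nlinarith [sq_nonneg (besselJ 0 (a * s))]
    · have hb0 : Tendsto (fun s => besselJ 0 (a * s) * besselJ 0 (b * s)) atTop (𝓝 0) :=
        squeeze_zero_norm (fun s => by
          rw [norm_mul]
          exact mul_le_of_le_one_right (norm_nonneg _) (abs_besselJ_le_one 0 _))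
          (tendsto_zero_iff_norm_tendsto_zero.1 (tendsto_besselJ_zero_mul ha))
      have hb1 : Tendsto (fun s => besselJ 1 (a * s) * besselJ 1 (b * s)) atTop (𝓝 0) :=
        squeeze_zero_norm (fun s => by
          rw [norm_mul]
          exact mul_le_of_le_one_right (norm_nonneg _) (abs_besselJ_le_one 1 _))
          (tendsto_zero_iff_norm_tendsto_zero.1 (tendsto_besselJ_one_mul ha))
      simpa using ((hb0.const_mul a).add (hb1.const_mul b)).div_const (b ^ 2 - a ^ 2)

/-- The pair `(j_1, J_0)`. -/
lemma isRadialPair_besselj1_besselJ_zero : IsRadialPair 1 besselj1 (besselJ 0) where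
  continuous_left := continuous_besselj1
  continuous_right := continuous_besselJ_zero
  left_zero := besselj1_zero
  right_zero := besselJ_zero_zero
  left_neg := besselj1_neg
  abs_left_le := abs_besselj1_le_one
  abs_right_le := abs_besselJ_le_one 0
  hasDerivAt x hx := (hasDerivAt_besselj1 hx).congr_deriv (by norm_num)
  decay := by
    obtain ⟨C, -, hC⟩ := exists_besselJ_decay
    refine ⟨4 * C, fun x => ?_⟩
    have h1 := hC |x| (abs_nonneg x)
    have h2 : besselJ 1 |x| ^ 2 = besselJ 1 x ^ 2 := by
      rcases abs_choice x with h | h <;> simp [h, besselJ_one_neg]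
    rw [h2, mul_add] at h1
    have h3 : 0 ≤ |x| * besselJ 0 |x| ^ 2 := by positivity
    calc besselj1 x ^ 2 * |x| ^ (1 + 2) = |x| * (x * besselj1 x) ^ 2 := by
          rw [mul_pow, ← sq_abs x]; ring
      _ = 4 * (|x| * besselJ 1 x ^ 2) := by rw [mul_besselj1]; ring
      _ ≤ 4 * C := by linarith
  converges a b ha := by
    obtain ⟨l, hl⟩ := improperConverges_besselJ_one_mul_besselJ_zero b ha
    refine ⟨2 / a * l, (hl.const_mul (2 / a)).congr fun T => ?_⟩
    rw [← intervalIntegral.integral_const_mul]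
    congr 1
    ext s
    have := mul_besselj1 (a * s)
    simp only [pow_one]
    generalize besselJ 0 (b * s) = w
    field_simp
    linear_combination (-w) * this

/-! ### Slices of the cube -/

/-- The cube `{x | max_i |x_i| ≤ α}` in the product space `𝕜ⁿ`. -/
def box (𝕜 : Type*) [RCLike 𝕜] (n : ℕ) (α : ℝ) : Set (Fin n → 𝕜) := {x | ∀ i, ‖x i‖ ≤ α}

lemma box_eq_pi (𝕜 : Type*) [RCLike 𝕜] (n : ℕ) (α : ℝ) :
    box 𝕜 n α = Set.univ.pi fun _ => Metric.closedBall 0 α := by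
  ext x
  simp [box]

lemma isCompact_box (𝕜 : Type*) [RCLike 𝕜] (n : ℕ) (α : ℝ) : IsCompact (box 𝕜 n α) := by
  rw [box_eq_pi]
  exact isCompact_univ_pi fun _ => isCompact_closedBall _ _

section Slice

set_option linter.unusedSectionVars false

variable {𝕜 : Type*} [RCLike 𝕜] [MeasureSpace 𝕜] [BorelSpace 𝕜]
  [(volume : Measure 𝕜).IsAddHaarMeasure] {m n : ℕ}

/-- The volume of the slice of the cube with first coordinate `t`, in the linear coordinates
given by `L`. -/
noncomputable def slice (L : (𝕜 × (Fin m → 𝕜)) ≃L[𝕜] (Fin n → 𝕜)) (α : ℝ) (t : 𝕜) : ℝ :=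
  (volume : Measure (Fin m → 𝕜)).real {y | L (t, y) ∈ box 𝕜 n α}

variable (L : (𝕜 × (Fin m → 𝕜)) ≃L[𝕜] (Fin n → 𝕜)) (α : ℝ)

lemma isCompact_preimage_box : IsCompact (L ⁻¹' box 𝕜 n α) :=
  L.toHomeomorph.isCompact_preimage.2 (isCompact_box 𝕜 n α)

lemma integral_indicator_slice {E : Type*} [NormedAddCommGroup E] [NormedSpace ℝ E]
    [CompleteSpace E] (g : 𝕜 → E) (t : 𝕜) :
    ∫ y, (L ⁻¹' box 𝕜 n α).indicator (fun p => g p.1) (t, y) = slice L α t • g t := by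
  have hK := (isCompact_preimage_box L α).isClosed.measurableSet
  have : ∀ y, (L ⁻¹' box 𝕜 n α).indicator (fun p => g p.1) (t, y) =
      (Prod.mk t ⁻¹' (L ⁻¹' box 𝕜 n α)).indicator (fun _ => g t) y := fun y => rfl
  simp only [this]
  rw [integral_indicator_const _ (measurable_prodMk_left hK)]
  rfl

lemma integrable_indicator_preimage_box {E : Type*} [NormedAddCommGroup E] {g : 𝕜 → E}
    (hg : Continuous g) :
    Integrable ((L ⁻¹' box 𝕜 n α).indicator fun p : 𝕜 × (Fin m → 𝕜) => g p.1) := by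
  have hK := isCompact_preimage_box L α
  rw [integrable_indicator_iff hK.isClosed.measurableSet]
  exact (hg.comp continuous_fst).continuousOn.integrableOn_compact hK

lemma integrable_slice : Integrable (slice L α) := by
  have h := (integrable_indicator_preimage_box L α
    (continuous_const : Continuous fun _ : 𝕜 => (1 : ℝ))).integral_prod_left
  simpa only [integral_indicator_slice L α (fun _ => (1 : ℝ)), smul_eq_mul, mul_one] using h

/-- Fubini's theorem for the slices of the cube. -/
lemma integral_slice_smul (hL : MeasurePreserving L) {g : 𝕜 → ℂ} (hg : Continuous g) :
    ∫ t, slice L α t • g t = ∫ x in box 𝕜 n α, g (L.symm x).1 := by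
  have hemb : MeasurableEmbedding L := L.toHomeomorph.measurableEmbedding
  have h1 := hL.setIntegral_preimage_emb hemb (fun x => g (L.symm x).1) (box 𝕜 n α)
  simp only [ContinuousLinearEquiv.symm_apply_apply] at h1
  rw [← h1, ← integral_indicator (isCompact_preimage_box L α).isClosed.measurableSet,
    Measure.volume_eq_prod, integral_prod _ (integrable_indicator_preimage_box L α hg)]
  simp only [integral_indicator_slice]

/-- A nonzero functional is onto, so it pulls the null sphere of radius α back to a null set; the
zero functional never reaches norm α > 0. -/
lemma ae_norm_linearMap_ne (ℓ : (Fin m → 𝕜) →ₗ[𝕜] 𝕜) (hα : 0 < α) : ∀ᵐ y, ‖ℓ y‖ ≠ α := by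
  by_cases hℓ : ℓ = 0
  · subst hℓ
    exact Eventually.of_forall fun y => by simpa using hα.ne
  · have hs : MeasurableSet {z : 𝕜 | ‖z‖ ≠ α} :=
      (measurableSet_eq_fun measurable_norm measurable_const).compl
    refine (ae_comp_linearMap_mem_iff ℓ volume volume (LinearMap.surjective hℓ) hs).2 ?_
    rw [ae_iff]
    convert! Measure.addHaar_sphere_of_ne_zero (volume : Measure 𝕜) (0 : 𝕜) hα.ne' using 2
    ext z
    simp

/-- The volume of the slices is continuous at the central slice. -/
lemma continuousAt_slice_zero (hα : 0 < α) : ContinuousAt (slice L α) 0 := by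
  set K := L ⁻¹' box 𝕜 n α with hKdef
  have hK : IsCompact K := isCompact_preimage_box L α
  have hKm := hK.isClosed.measurableSet
  have hP : IsCompact (Prod.snd '' K) := hK.image continuous_snd
  have heq : slice L α = fun t => ∫ y, K.indicator (fun _ => (1 : ℝ)) (t, y) := by
    ext t
    rw [integral_indicator_slice L α (fun _ => (1 : ℝ)), smul_eq_mul, mul_one]
  rw [heq]
  -- Almost no point of the central slice has a coordinate of modulus exactly α. Off this null set
  -- the indicator is locally constant in t near 0, so dominated convergence applies.
  have hae : ∀ᵐ y : Fin m → 𝕜, ∀ i, ‖L (0, y) i‖ ≠ α := ae_all_iff.2 fun i =>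
    ae_norm_linearMap_ne α (LinearMap.proj i ∘ₗ L.toLinearMap ∘ₗ LinearMap.inr 𝕜 𝕜 (Fin m → 𝕜)) hα
  refine continuousAt_of_dominated (bound := (Prod.snd '' K).indicator fun _ => (1 : ℝ))
    (Eventually.of_forall fun t => ?_) (Eventually.of_forall fun t => Eventually.of_forall fun y => ?_)
    ?_ ?_
  · exact ((measurable_const.indicator hKm).comp measurable_prodMk_left).aestronglyMeasurable
  · by_cases h : (t, y) ∈ K
    · rw [Set.indicator_of_mem h, Set.indicator_of_mem (Set.mem_image_of_mem Prod.snd h)]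
      simp
    · rw [Set.indicator_of_notMem h, norm_zero]
      exact Set.indicator_nonneg (fun _ _ => zero_le_one) _
  · rw [integrable_indicator_iff hP.isClosed.measurableSet]
    exact continuous_const.continuousOn.integrableOn_compact hP
  · filter_upwards [hae] with y hy
    have hc : ∀ i, Continuous fun t : 𝕜 => ‖L (t, y) i‖ := fun i => by fun_prop
    by_cases h : ∀ i, ‖L (0, y) i‖ ≤ α
    · have hev : ∀ᶠ t in 𝓝 (0 : 𝕜), ∀ i, ‖L (t, y) i‖ < α := eventually_all.2 fun i =>
        (hc i).continuousAt.eventually_lt continuousAt_const (lt_of_le_of_ne (h i) (hy i))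
      refine (continuousAt_const (y := (1 : ℝ))).congr ?_
      filter_upwards [hev] with t ht
      exact (Set.indicator_of_mem (show (t, y) ∈ K from fun i => (ht i).le) fun _ => (1 : ℝ)).symm
    · push Not at h
      obtain ⟨i, hi⟩ := h
      refine (continuousAt_const (y := (0 : ℝ))).congr ?_
      filter_upwards [continuousAt_const.eventually_lt (hc i).continuousAt hi] with t ht
      exact (Set.indicator_of_notMem (show (t, y) ∉ K from fun hmem => (hmem i).not_gt ht)
        fun _ => (1 : ℝ)).symm

lemma integral_box_prod (f : Fin n → 𝕜 → ℂ) :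
    ∫ x in box 𝕜 n α, ∏ i, f i (x i) = ∏ i, ∫ z in Metric.closedBall (0 : 𝕜) α, f i z := by
  rw [box_eq_pi, volume_pi, Measure.restrict_pi_pi]
  exact integral_fintype_prod_eq_prod f

/-- The integral of a character against the slice volumes factors over the coordinates. -/
lemma integral_slice_smul_eq_prod (hL : MeasurePreserving L) (a : Fin n → 𝕜)
    (ha : ∀ t y, ∑ i, a i * L (t, y) i = t) (g : 𝕜 → ℂ) (hg : Continuous g)
    (g_zero : g 0 = 1) (g_add : ∀ s t, g (s + t) = g s * g t) :
    ∫ t, slice L α t • g t = ∏ i, ∫ z in Metric.closedBall (0 : 𝕜) α, g (a i * z) := by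
  rw [integral_slice_smul L α hL hg, ← integral_box_prod]
  congr 1
  ext x
  have h1 := ha (L.symm x).1 (L.symm x).2
  simp only [Prod.mk.eta, ContinuousLinearEquiv.apply_symm_apply] at h1
  rw [← h1]
  -- As a monoid homomorphism, g turns the sum t = ∑ a_i x_i into a product of functions of the
  -- single coordinates.
  let G : Multiplicative 𝕜 →* ℂ :=
    { toFun := fun s => g s.toAdd, map_one' := g_zero, map_mul' := fun s t => g_add _ _ }
  exact map_prod G (fun i => Multiplicative.ofAdd (a i * x i)) Finset.univ

end Slice

/-! ### Fourier inversion and normalisation of the Hausdorff measure -/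

/-- Fourier inversion at the origin. -/
lemma eq_integral_of_fourier {V : Type*} [NormedAddCommGroup V] [InnerProductSpace ℝ V]
    [FiniteDimensional ℝ V] [MeasurableSpace V] [BorelSpace V] {F ψ : V → ℝ} (hF : Integrable F)
    (hF0 : ContinuousAt F 0) (hψ : Integrable ψ)
    (h : ∀ w, ∫ t, F t • (Real.fourierChar (-inner ℝ t w) : ℂ) = (ψ w : ℂ)) :
    F 0 = ∫ w, ψ w := by
  have h1 : FourierTransform.fourier (fun t => (F t : ℂ)) = fun w => (ψ w : ℂ) := by
    ext w
    rw [Real.fourier_eq, ← h]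
    congr 1
    ext t
    rw [Circle.smul_def, smul_eq_mul, Complex.real_smul, mul_comm]
  have h2 := Integrable.fourierInv_fourier_eq (f := fun t => (F t : ℂ)) hF.ofReal
    (h1 ▸ hψ.ofReal) (v := 0) (Complex.continuous_ofReal.continuousAt.comp hF0)
  rw [h1, Real.fourierInv_eq] at h2
  simp only [inner_zero_right, AddChar.map_zero_eq_one, one_smul] at h2
  rw [integral_complex_ofReal] at h2
  exact_mod_cast h2.symm

/-- Used to identify ℝ^(m×2) with (ℝ²)^m when ℂᵐ is read as ℝ²ᵐ; it is enough to compare the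
measures on boxes. -/
lemma measurePreserving_piCurry_symm {ι : Type*} [Fintype ι] {κ : ι → Type*} [∀ i, Fintype (κ i)] :
    MeasurePreserving (MeasurableEquiv.piCurry fun (i : ι) (_ : κ i) => ℝ).symm := by
  refine ⟨(MeasurableEquiv.piCurry fun (i : ι) (_ : κ i) => ℝ).symm.measurable, ?_⟩
  refine (Measure.pi_eq fun s _ => ?_).symm
  rw [MeasurableEquiv.map_apply]
  have : (MeasurableEquiv.piCurry fun (i : ι) (_ : κ i) => ℝ).symm ⁻¹' Set.univ.pi s =
      Set.univ.pi fun i => Set.univ.pi fun j => s ⟨i, j⟩ := by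
    ext x
    simp [MeasurableEquiv.coe_piCurry_symm, Sigma.uncurry, Sigma.forall]
  rw [this, volume_pi_pi]
  simp only [volume_pi_pi]
  rw [Fintype.prod_sigma]

/-- The Hausdorff measure on `ℝᵐ` is the product measure. -/
lemma measurePreserving_ofLp_real (m : ℕ) :
    MeasurePreserving (WithLp.ofLp : EuclideanSpace ℝ (Fin m) → Fin m → ℝ) μHE[m] volume := by
  rw [EuclideanSpace.euclideanHausdorffMeasure_eq_volume]
  exact PiLp.volume_preserving_ofLp (Fin m)

/-- The Hausdorff measure of real dimension `2m` on `ℂᵐ` is the product measure. -/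
lemma measurePreserving_ofLp_complex (m : ℕ) :
    MeasurePreserving (WithLp.ofLp : EuclideanSpace ℂ (Fin m) → Fin m → ℂ) μHE[2 * m] volume := by
  let b : OrthonormalBasis ((_ : Fin m) × Fin 2) ℝ (EuclideanSpace ℂ (Fin m)) :=
    Pi.orthonormalBasis fun _ => Complex.orthonormalBasisOneI
  have hfin : Module.finrank ℝ (EuclideanSpace ℂ (Fin m)) = 2 * m := by
    rw [Module.finrank_eq_card_basis b.toBasis]
    simp [mul_comm]
  have hvol : (μHE[2 * m] : Measure (EuclideanSpace ℂ (Fin m))) = volume := by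
    rw [← hfin]
    exact InnerProductSpace.euclideanHausdorffMeasure_eq_volume
  rw [hvol]
  have h1 := b.measurePreserving_repr
  have h2 := PiLp.volume_preserving_ofLp ((_ : Fin m) × Fin 2)
  have h3 : MeasurePreserving (MeasurableEquiv.piCurry fun (_ : Fin m) (_ : Fin 2) => ℝ) :=
    (measurePreserving_piCurry_symm (ι := Fin m) (κ := fun _ => Fin 2)).symm
  have h4 := volume_preserving_pi (ι := Fin m) fun _ => Complex.volume_preserving_equiv_pi.symm
  convert! h4.comp (h3.comp (h2.comp h1)) using 1
  ext x i
  apply Complex.measurableEquivPi.injective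
  simp only [Function.comp, MeasurableEquiv.apply_symm_apply]
  ext j
  fin_cases j <;> simp [Sigma.curry, b, Pi.orthonormalBasis] <;> rfl

/-! ### Coordinates adapted to a hyperplane section -/

section Section

set_option linter.unusedSectionVars false

variable {𝕜 : Type*} [RCLike 𝕜] [MeasureSpace 𝕜] [BorelSpace 𝕜]
  [(volume : Measure 𝕜).IsAddHaarMeasure] {m n d : ℕ}

/-- The inclusion of the `k`-th coordinate hyperplane. -/
noncomputable def coordinateHyperplane (k : Fin (m + 1)) :
    EuclideanSpace 𝕜 (Fin m) →ₗᵢ[𝕜] EuclideanSpace 𝕜 (Fin (m + 1)) where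
  toFun y := WithLp.toLp 2 (k.insertNth 0 y.ofLp)
  map_add' x y := by
    ext i
    refine Fin.succAboveCases k ?_ (fun j => ?_) i <;> simp
  map_smul' c x := by
    ext i
    refine Fin.succAboveCases k ?_ (fun j => ?_) i <;> simp
  norm_map' x := by
    simp [EuclideanSpace.norm_eq, Fin.sum_univ_succAbove _ k]

lemma coordinateHyperplane_apply (k : Fin (m + 1)) (y : EuclideanSpace 𝕜 (Fin m)) :
    coordinateHyperplane k y = WithLp.toLp 2 (k.insertNth 0 y.ofLp) := rfl

lemma range_coordinateHyperplane (k : Fin (m + 1)) :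
    Set.range (coordinateHyperplane (𝕜 := 𝕜) k) = {x | x k = 0} := by
  ext x
  constructor
  · rintro ⟨y, rfl⟩
    simp [coordinateHyperplane_apply]
  · intro hx
    refine ⟨WithLp.toLp 2 fun j => x (k.succAbove j), ?_⟩
    ext i
    refine Fin.succAboveCases k ?_ (fun j => ?_) i
    · simpa [coordinateHyperplane_apply] using (show x k = 0 from hx).symm
    · simp [coordinateHyperplane_apply]

/-- A linear isometry preserves Hausdorff measure, so the section can be measured in its parameter
space, where `hd` makes it Lebesgue measure. Here d stands for the real dimension of 𝕜, which lets
one argument serve ℝ and ℂ. -/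
lemma real_cube_inter_range
    (hd : ∀ m, MeasurePreserving (WithLp.ofLp : EuclideanSpace 𝕜 (Fin m) → Fin m → 𝕜)
      μHE[d * m] volume) (ι : EuclideanSpace 𝕜 (Fin m) →ₗᵢ[𝕜] EuclideanSpace 𝕜 (Fin n)) (α : ℝ) :
    (μHE[d * m] : Measure (EuclideanSpace 𝕜 (Fin n))).real (cube 𝕜 n α ∩ Set.range ι) =
      volume.real {y : Fin m → 𝕜 | (ι (WithLp.toLp 2 y)).ofLp ∈ box 𝕜 n α} := by
  rw [Measure.real, Measure.real, ← ι.isometry.euclideanHausdorffMeasure_preimage,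
    ← (hd m).measure_preimage]
  · rfl
  · refine MeasurableSet.nullMeasurableSet (IsClosed.measurableSet ?_)
    exact (isCompact_box 𝕜 n α).isClosed.preimage (by have := ι.continuous; fun_prop)

lemma mem_orthogonal_span_singleton_iff (a x : EuclideanSpace 𝕜 (Fin n)) :
    x ∈ (Submodule.span 𝕜 {a})ᗮ ↔ inner 𝕜 a x = 0 :=
  Submodule.mem_orthogonal_singleton_iff_inner_right

/-- Linear coordinates adapted to a unit vector `a`, in which the first coordinate of `x` is
`⟨a, x⟩`, and the volume of the central slice. -/
lemma exists_coordinates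
    (hd : ∀ m, MeasurePreserving (WithLp.ofLp : EuclideanSpace 𝕜 (Fin m) → Fin m → 𝕜)
      μHE[d * m] volume) (a : EuclideanSpace 𝕜 (Fin (m + 1))) (ha : ‖a‖ = 1) :
    ∃ L : (𝕜 × (Fin m → 𝕜)) ≃L[𝕜] (Fin (m + 1) → 𝕜), MeasurePreserving L ∧
      (∀ t y, ∑ i, (starRingEnd 𝕜) (a i) * L (t, y) i = t) ∧
      ∀ α, (μHE[d * m] : Measure (EuclideanSpace 𝕜 (Fin (m + 1)))).real
        (cube 𝕜 (m + 1) α ∩ ((Submodule.span 𝕜 {a})ᗮ : Set (EuclideanSpace 𝕜 (Fin (m + 1))))) =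
          slice L α 0 := by
  -- Complete a to an orthonormal basis with b 0 = a; L is then the isometric change of coordinates,
  -- whose first coordinate is ⟨a, x⟩.
  obtain ⟨b, hb⟩ := Orthonormal.exists_orthonormalBasis_extension_of_card_eq (𝕜 := 𝕜)
    (E := EuclideanSpace 𝕜 (Fin (m + 1))) (ι := Fin (m + 1)) (by simp) (v := fun _ => a) (s := {0})
    (by
      rw [orthonormal_iff_ite]
      rintro ⟨i, rfl⟩ ⟨j, rfl⟩
      simp [Set.domRestrict, inner_self_eq_norm_sq_to_K, ha])
  have hb0 : b 0 = a := hb 0 rfl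
  let e1 := Fin.consEquivL 𝕜 (fun _ : Fin (m + 1) => 𝕜)
  let e2 := (PiLp.continuousLinearEquiv 2 𝕜 (fun _ : Fin (m + 1) => 𝕜))
  let L : (𝕜 × (Fin m → 𝕜)) ≃L[𝕜] (Fin (m + 1) → 𝕜) :=
    ((e1.trans e2.symm).trans b.repr.symm.toContinuousLinearEquiv).trans e2
  have hLapp : ∀ t y, L (t, y) = (b.repr.symm (WithLp.toLp 2 (Fin.cons t y))).ofLp :=
    fun t y => rfl
  refine ⟨L, ?_, fun t y => ?_, fun α => ?_⟩
  · have h1 : MeasurePreserving e1 := by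
      have h := (volume_preserving_piFinSuccAbove (fun _ : Fin (m + 1) => 𝕜) 0).symm
      have he : ⇑e1 = ⇑(MeasurableEquiv.piFinSuccAbove (fun _ : Fin (m + 1) => 𝕜) 0).symm := by
        ext p i
        refine Fin.cases ?_ (fun j => ?_) i <;> rfl
      rw [he]
      exact h
    have h2 := hd (m + 1)
    have h3 : MeasurePreserving (WithLp.toLp 2 : (Fin (m + 1) → 𝕜) → _) volume μHE[d * (m + 1)] :=
      MeasurePreserving.symm (MeasurableEquiv.toLp 2 (Fin (m + 1) → 𝕜)).symm h2
    have h4 := b.repr.symm.toIsometryEquiv.measurePreserving_euclideanHausdorffMeasure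
      (d * (m + 1))
    exact h2.comp (h4.comp (h3.comp h1))
  · have h1 : b.repr (b.repr.symm (WithLp.toLp 2 (Fin.cons t y))) 0 = t := by simp
    rw [b.repr_apply_apply, hb0, PiLp.inner_apply] at h1
    rw [hLapp]
    simpa [mul_comm] using h1
  · have h1 := real_cube_inter_range hd
      (b.repr.symm.toLinearIsometry.comp (coordinateHyperplane 0)) α
    have h2 : Set.range (b.repr.symm.toLinearIsometry.comp (coordinateHyperplane (𝕜 := 𝕜) 0)) =
        ((Submodule.span 𝕜 {a})ᗮ : Set (EuclideanSpace 𝕜 (Fin (m + 1)))) := by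
      ext x
      rw [SetLike.mem_coe, mem_orthogonal_span_singleton_iff, ← hb0, ← b.repr_apply_apply]
      rw [LinearIsometry.coe_comp, Set.range_comp, range_coordinateHyperplane]
      simp only [LinearIsometryEquiv.coe_toLinearIsometry, Set.mem_image, Set.mem_ofPred_eq]
      constructor
      · rintro ⟨y, hy, rfl⟩
        simpa using hy
      · exact fun hx => ⟨b.repr x, hx, by simp⟩
    have h3 : ∀ y : Fin m → 𝕜, ((b.repr.symm.toLinearIsometry.comp (coordinateHyperplane 0))
        (WithLp.toLp 2 y)).ofLp = L (0, y) := by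
      intro y
      rw [hLapp]
      change (b.repr.symm (coordinateHyperplane 0 (WithLp.toLp 2 y))).ofLp = _
      rw [coordinateHyperplane_apply, Fin.insertNth_zero']
    rw [← h2, h1, slice]
    simp only [h3]

/-- The section of the cube by a coordinate hyperplane is a cube. -/
lemma real_cube_inter_coordinate
    (hd : ∀ m, MeasurePreserving (WithLp.ofLp : EuclideanSpace 𝕜 (Fin m) → Fin m → 𝕜)
      μHE[d * m] volume) (a : EuclideanSpace 𝕜 (Fin (m + 1))) {k : Fin (m + 1)} (hk : a k ≠ 0)
      (ha : ∀ j, j ≠ k → a j = 0) {α : ℝ} (hα : 0 ≤ α) :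
    (μHE[d * m] : Measure (EuclideanSpace 𝕜 (Fin (m + 1)))).real
      (cube 𝕜 (m + 1) α ∩ ((Submodule.span 𝕜 {a})ᗮ : Set (EuclideanSpace 𝕜 (Fin (m + 1))))) =
        (volume : Measure 𝕜).real (Metric.closedBall 0 α) ^ m := by
  have h2 : ((Submodule.span 𝕜 {a})ᗮ : Set (EuclideanSpace 𝕜 (Fin (m + 1)))) =
      Set.range (coordinateHyperplane (𝕜 := 𝕜) k) := by
    ext x
    rw [range_coordinateHyperplane, SetLike.mem_coe, mem_orthogonal_span_singleton_iff,
      PiLp.inner_apply, Finset.sum_eq_single k]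
    · simp [hk]
    · intro j _ hj
      simp [ha j hj]
    · simp
  rw [h2, real_cube_inter_range hd]
  have h3 : {y : Fin m → 𝕜 | (coordinateHyperplane k (WithLp.toLp 2 y)).ofLp ∈ box 𝕜 (m + 1) α} =
      Set.univ.pi fun _ => Metric.closedBall 0 α := by
    ext y
    simp [box, coordinateHyperplane_apply, k.forall_iff_succAbove, hα]
  rw [h3, Measure.real, volume_pi_pi]
  simp [Measure.real]

end Section

/-! ### Fourier transforms of the interval and the disc -/

lemma integral_closedBall_fourierChar_real (c w : ℝ) :
    ∫ z in Metric.closedBall (0 : ℝ) (1 / 2), (Real.fourierChar (-inner ℝ (c * z) w) : ℂ) =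
      (Real.sinc (c * (Real.pi * ‖w‖)) : ℝ) := by
  have hsinc : Real.sinc (c * (Real.pi * ‖w‖)) = Real.sinc (c * (Real.pi * w)) := by
    rw [Real.norm_eq_abs]
    rcases abs_choice w with h | h <;> rw [h]
    rw [mul_neg, mul_neg, Real.sinc_neg]
  rw [hsinc, Real.closedBall_eq_Icc, integral_Icc_eq_integral_Ioc,
    ← intervalIntegral.integral_of_le (by norm_num)]
  have h1 : ∀ z : ℝ, (Real.fourierChar (-inner ℝ (c * z) w) : ℂ) =
      Complex.exp (((-(2 * c * (Real.pi * w)) * z : ℝ) : ℂ) * Complex.I) := by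
    intro z
    rw [Real.fourierChar_apply]
    congr 2
    simp
    ring
  simp only [h1]
  rcases eq_or_ne (c * (Real.pi * w)) 0 with h0 | h0
  · rw [h0]
    have : ∀ z : ℝ, -(2 * c * (Real.pi * w)) * z = 0 := fun z => by
      rw [mul_assoc 2, h0]; simp
    simp only [this]
    norm_num
  · have h2 := intervalIntegral.integral_comp_mul_left (a := 0 - 1 / 2) (b := 0 + 1 / 2)
      (fun x : ℝ => Complex.exp ((x : ℂ) * Complex.I)) (c := -(2 * c * (Real.pi * w)))
      (by rw [mul_assoc 2]; simpa using h0)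
    rw [h2]
    have h3 : -(2 * c * (Real.pi * w)) * (0 - 1 / 2) = - -(c * (Real.pi * w)) := by ring
    have h4 : -(2 * c * (Real.pi * w)) * (0 + 1 / 2) = -(c * (Real.pi * w)) := by ring
    rw [h3, h4, integral_exp_mul_I_eq_sinc, Real.sinc_neg, mul_assoc 2 c]
    generalize c * (Real.pi * w) = q at h0
    have : (q : ℂ) ≠ 0 := by exact_mod_cast h0
    rw [Complex.real_smul]
    push_cast
    field_simp

lemma integral_cexp_sin (x : ℝ) :
    ∫ θ in -Real.pi..Real.pi, Complex.exp (((-(x * Real.sin θ) : ℝ) : ℂ) * Complex.I) =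
      ((2 * Real.pi * besselJ 0 x : ℝ) : ℂ) := by
  have hc : ∀ s : ℝ, Continuous fun θ : ℝ =>
      Complex.exp (((s * (x * Real.sin θ) : ℝ) : ℂ) * Complex.I) := fun s => by fun_prop
  have h1 := intervalIntegral.integral_comp_neg (a := 0) (b := Real.pi)
    (fun θ : ℝ => Complex.exp (((-(x * Real.sin θ) : ℝ) : ℂ) * Complex.I))
  rw [neg_zero] at h1
  have hi1 := (hc 1).intervalIntegrable (μ := volume)
  have hi2 := (hc (-1)).intervalIntegrable (μ := volume)
  simp only [one_mul, neg_one_mul] at hi1 hi2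
  simp only [Real.sin_neg, mul_neg, neg_neg] at h1
  rw [← intervalIntegral.integral_add_adjacent_intervals (hi2 (-Real.pi) 0) (hi2 0 Real.pi), ← h1,
    ← intervalIntegral.integral_add (hi1 _ _) (hi2 _ _)]
  have h2 : ∀ θ : ℝ, Complex.exp (((x * Real.sin θ : ℝ) : ℂ) * Complex.I) +
      Complex.exp (((-(x * Real.sin θ) : ℝ) : ℂ) * Complex.I) =
        ((2 * Real.cos (x * Real.sin θ) : ℝ) : ℂ) := fun θ => by
    rw [Complex.ofReal_neg, ← Complex.two_cos]
    push_cast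
    rfl
  simp only [h2]
  rw [intervalIntegral.integral_ofReal, intervalIntegral.integral_const_mul, besselJ_zero_eq]
  congr 1
  field_simp

/-- The radial pair relation in integrated form: (ρ² j_1(ρy))' = 2ρ J_0(ρy). -/
lemma integral_mul_besselJ_zero (y : ℝ) {r : ℝ} (hr : 0 ≤ r) :
    ∫ ρ in (0 : ℝ)..r, ρ * (2 * Real.pi * besselJ 0 (ρ * y)) =
      Real.pi * r ^ 2 * besselj1 (r * y) := by
  have hc0 := continuous_besselJ_zero
  have hc1 := continuous_besselj1
  have h := intervalIntegral.integral_eq_sub_of_hasDerivAt_of_le hr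
    (f := fun ρ => Real.pi * ρ ^ 2 * besselj1 (ρ * y))
    (f' := fun ρ => ρ * (2 * Real.pi * besselJ 0 (ρ * y))) (by fun_prop)
    (fun ρ hρ => by
      have h1 := isRadialPair_besselj1_besselJ_zero.hasDerivAt_comp_mul y hρ.1
      simp only [mul_comm y] at h1
      refine ((((hasDerivAt_pow 2 ρ).const_mul Real.pi)).mul h1).congr_deriv ?_
      have := hρ.1.ne'
      push_cast
      norm_num
      field_simp
      ring)
    ((by fun_prop : Continuous _).intervalIntegrable _ _)
  rw [h]
  simp

/-- The Fourier transform of the disc, on the imaginary axis. -/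
lemma integral_closedBall_cexp_im (y : ℝ) {r : ℝ} (hr : 0 ≤ r) :
    ∫ z in Metric.closedBall (0 : ℂ) r, Complex.exp (((-(y * z.im) : ℝ) : ℂ) * Complex.I) =
      ((Real.pi * r ^ 2 * besselj1 (r * y) : ℝ) : ℂ) := by
  set h : ℝ × ℝ → ℂ := fun p =>
    p.1 • Complex.exp (((-(p.1 * y * Real.sin p.2) : ℝ) : ℂ) * Complex.I) with hh
  have hc : Continuous h := by fun_prop
  -- In polar coordinates the angular integral is 2π J_0, and the radial integral of ρ J_0 then
  -- produces j_1.
  rw [← integral_indicator Metric.isClosed_closedBall.measurableSet,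
    ← Complex.integral_comp_polarCoord_symm]
  have h1 : ∀ p ∈ polarCoord.target, p.1 • (Metric.closedBall (0 : ℂ) r).indicator
      (fun z => Complex.exp (((-(y * z.im) : ℝ) : ℂ) * Complex.I)) (Complex.polarCoord.symm p) =
      (Set.Iic r ×ˢ Set.univ).indicator h p := by
    intro p hp
    have hp0 : 0 < p.1 := hp.1
    have him : (Complex.polarCoord.symm p).im = p.1 * Real.sin p.2 := by
      rw [Complex.polarCoord_symm_apply]
      simp [-Complex.ofReal_sin]
    by_cases hpr : p.1 ≤ r
    · rw [Set.indicator_of_mem (by simpa [abs_of_pos hp0] using hpr),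
        Set.indicator_of_mem (by simpa using hpr), him, hh]
      simp only
      congr 4
      ring
    · rw [Set.indicator_of_notMem (by simpa [abs_of_pos hp0] using hpr),
        Set.indicator_of_notMem (by simpa using hpr), smul_zero]
  have hinter : polarCoord.target ∩ (Set.Iic r ×ˢ Set.univ) =
      Set.Ioc 0 r ×ˢ Set.Ioo (-Real.pi) Real.pi := by
    ext p
    simp [polarCoord_target]
    tauto
  have hint : IntegrableOn h (Set.Ioc 0 r ×ˢ Set.Ioo (-Real.pi) Real.pi)
      (volume.prod volume) :=
    (hc.continuousOn.integrableOn_compact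
      (isCompact_Icc (a := (0 : ℝ)) (b := r) |>.prod
        (isCompact_Icc (a := -Real.pi) (b := Real.pi)))).mono_set
      (Set.prod_mono Set.Ioc_subset_Icc_self Set.Ioo_subset_Icc_self)
  rw [setIntegral_congr_fun polarCoord.open_target.measurableSet h1,
    setIntegral_indicator (measurableSet_Iic.prod MeasurableSet.univ), hinter,
    Measure.volume_eq_prod, setIntegral_prod _ hint]
  have hin : ∀ ρ : ℝ, ∫ θ in Set.Ioo (-Real.pi) Real.pi, h (ρ, θ) =
      ((ρ * (2 * Real.pi * besselJ 0 (ρ * y)) : ℝ) : ℂ) := by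
    intro ρ
    simp only [hh]
    rw [integral_smul, ← integral_Ioc_eq_integral_Ioo,
      ← intervalIntegral.integral_of_le (by linarith [Real.pi_pos]), integral_cexp_sin,
      Complex.real_smul, ← Complex.ofReal_mul]
  simp only [hin]
  rw [integral_complex_ofReal, ← intervalIntegral.integral_of_le hr, integral_mul_besselJ_zero y hr]

/-- The rotation ξ = -i w/‖w‖ sends i to the direction of w. The imaginary axis is chosen because Im
z = ρ sin θ matches the integral defining J_0. -/
lemma exists_rotation_inner_eq (w : ℂ) :
    ∃ ξ : Circle, ∀ z : ℂ, inner ℝ (ξ * z) w = ‖w‖ * z.im := by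
  rcases eq_or_ne w 0 with rfl | hw
  · exact ⟨1, fun z => by simp⟩
  · have hn : (‖w‖ : ℂ) ≠ 0 := by simpa using hw
    refine ⟨⟨w / ‖w‖ * -Complex.I, ?_⟩, fun z => ?_⟩
    · simp [Submonoid.unitSphere, hw]
    · have h1 : (w / ‖w‖ * -Complex.I) * (‖w‖ * Complex.I) = w := by
        field_simp
        simp
      have h2 : (starRingEnd ℂ) (w / ‖w‖ * -Complex.I) * (w / ‖w‖ * -Complex.I) = 1 := by
        rw [mul_comm, Complex.mul_conj, Complex.normSq_eq_norm_sq]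
        simp [hw]
      rw [Complex.inner, mul_comm w]
      change ((starRingEnd ℂ) ((w / ‖w‖ * -Complex.I) * z) * w).re = _
      generalize w / ‖w‖ * -Complex.I = ξ at h1 h2 ⊢
      have h3 : (starRingEnd ℂ) (ξ * z) * (ξ * (‖w‖ * Complex.I)) =
          (starRingEnd ℂ) ξ * ξ * ((starRingEnd ℂ) z * (‖w‖ * Complex.I)) := by
        rw [map_mul]; ring
      rw [h1] at h3
      rw [h3, h2]
      simp [mul_comm]

/-- The Fourier transform of the disc of area one. -/
lemma integral_closedBall_fourierChar_complex (c : ℝ) (w : ℂ) :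
    ∫ z in Metric.closedBall (0 : ℂ) (1 / Real.sqrt Real.pi),
      (Real.fourierChar (-inner ℝ ((c : ℂ) * z) w) : ℂ) =
      (besselj1 (c * (2 * Real.sqrt Real.pi * ‖w‖)) : ℝ) := by
  obtain ⟨ξ, hξ⟩ := exists_rotation_inner_eq w
  have hpre : (rotation ξ) ⁻¹' Metric.closedBall (0 : ℂ) (1 / Real.sqrt Real.pi) =
      Metric.closedBall (0 : ℂ) (1 / Real.sqrt Real.pi) := by
    ext z
    simp only [Set.mem_preimage, Metric.mem_closedBall, dist_zero_right,
      LinearIsometryEquiv.norm_map]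
  have h1 := (rotation ξ).measurePreserving.setIntegral_preimage_emb
    (rotation ξ).toHomeomorph.measurableEmbedding
    (fun z => (Real.fourierChar (-inner ℝ ((c : ℂ) * z) w) : ℂ))
    (Metric.closedBall (0 : ℂ) (1 / Real.sqrt Real.pi))
  rw [hpre] at h1
  rw [← h1]
  have h2 : ∀ z : ℂ, (Real.fourierChar (-inner ℝ ((c : ℂ) * rotation ξ z) w) : ℂ) =
      Complex.exp (((-((2 * Real.pi * c * ‖w‖) * z.im) : ℝ) : ℂ) * Complex.I) := by
    intro z
    rw [← Complex.real_smul, real_inner_smul_left, rotation_apply, hξ, Real.fourierChar_apply]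
    congr 3
    ring
  simp only [h2]
  rw [integral_closedBall_cexp_im _ (by positivity)]
  congr 1
  have hs : Real.sqrt Real.pi ^ 2 = Real.pi := Real.sq_sqrt Real.pi_pos.le
  have h3 : Real.pi * (1 / Real.sqrt Real.pi) ^ 2 = 1 := by
    rw [div_pow, hs, one_pow, mul_one_div_cancel Real.pi_ne_zero]
  rw [h3, one_mul]
  congr 1
  have hs0 : Real.sqrt Real.pi ≠ 0 := by positivity
  field_simp
  linear_combination (-c * ‖w‖) * hs

/-! ### Inversion in polar coordinates and the Dirichlet integral -/

/-- Fourier inversion at the origin for a radial product. -/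
lemma IsRadialPair.eq_integral_of_fourier {V : Type*} [NormedAddCommGroup V]
    [InnerProductSpace ℝ V] [FiniteDimensional ℝ V] [MeasurableSpace V] [BorelSpace V]
    {d n : ℕ} {u v : ℝ → ℝ} (h : IsRadialPair d u v) (hV : Module.finrank ℝ V = d + 1)
    {a : Fin n → ℝ} {i j : Fin n} (hij : i ≠ j) (hai : a i ≠ 0) (haj : a j ≠ 0)
    {κ : ℝ} (hκ : 0 < κ) {F : V → ℝ} (hF : Integrable F) (hF0 : ContinuousAt F 0)
    (hFt : ∀ w, ∫ t, F t • (Real.fourierChar (-inner ℝ t w) : ℂ) =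
      ((∏ k, u (a k * (κ * ‖w‖)) : ℝ) : ℂ)) :
    F 0 = (d + 1) * (volume : Measure V).real (Metric.ball 0 1) / κ ^ (d + 1) *
      ∫ s in Set.Ioi 0, s ^ d * ∏ k, u (a k * s) := by
  have : Nontrivial V := Module.nontrivial_of_finrank_pos (R := ℝ) (by omega)
  set f : ℝ → ℝ := fun s => s ^ d * ∏ k, u (a k * s) with hf
  have hfκ : ∀ y : ℝ, f (κ * y) = κ ^ d * (y ^ d * ∏ k, u (a k * (κ * y))) := fun y => by
    simp only [hf]; ring
  have hsc : (fun y : ℝ => y ^ d * ∏ k, u (a k * (κ * y))) = fun y => (κ ^ d)⁻¹ * f (κ * y) := by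
    ext y
    rw [hfκ, inv_mul_cancel_left₀ (by positivity)]
  have hint : IntegrableOn (fun y : ℝ => f (κ * y)) (Set.Ioi 0) := by
    rw [integrableOn_Ioi_comp_mul_left_iff f 0 hκ, mul_zero]
    exact h.integrableOn_prod a hij hai haj
  have hψ : Integrable fun w : V => ∏ k, u (a k * (κ * ‖w‖)) := by
    refine (integrable_fun_norm_addHaar (volume : Measure V)
      (f := fun y : ℝ => ∏ k, u (a k * (κ * y)))).2 ?_
    simp only [hV, Nat.add_sub_cancel_right, smul_eq_mul]
    rw [hsc]
    exact hint.const_mul _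
  -- The area of the unit sphere, (d+1) times the volume of the unit ball, comes from polar
  -- coordinates; the substitution s = κ‖w‖ contributes κ^(-(d+1)).
  rw [_root_.eq_integral_of_fourier hF hF0 hψ hFt,
    integral_fun_norm_addHaar (volume : Measure V) (fun y : ℝ => ∏ k, u (a k * (κ * y)))]
  simp only [hV, Nat.add_sub_cancel_right, smul_eq_mul, nsmul_eq_mul]
  rw [hsc, integral_const_mul, integral_comp_mul_left_Ioi f 0 hκ, mul_zero, smul_eq_mul]
  push_cast
  rw [pow_succ]
  field_simp

/-- The shear `(t, y) ↦ (t - y, y)`. -/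
noncomputable def shear : (ℝ × (Fin 1 → ℝ)) ≃L[ℝ] (Fin 2 → ℝ) :=
  LinearEquiv.toContinuousLinearEquiv
    { toFun := fun p => ![p.1 - p.2 0, p.2 0]
      invFun := fun x => (x 0 + x 1, fun _ => x 1)
      map_add' := fun p q => by
        ext i
        fin_cases i
        · simp; ring
        · simp
      map_smul' := fun c p => by
        ext i
        fin_cases i
        · simp; ring
        · simp
      left_inv := fun p => by
        ext i
        · simp
        · simp [Subsingleton.elim i 0]
      right_inv := fun x => by
        ext i
        fin_cases i <;> simp }

lemma shear_apply (t : ℝ) (y : Fin 1 → ℝ) : shear (t, y) = ![t - y 0, y 0] := rfl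

lemma measurePreserving_shear : MeasurePreserving shear := by
  have h1 : MeasurePreserving (Prod.map id (MeasurableEquiv.funUnique (Fin 1) ℝ))
      (volume : Measure (ℝ × (Fin 1 → ℝ))) (volume : Measure (ℝ × ℝ)) :=
    (MeasurePreserving.id volume).prod (volume_preserving_funUnique (Fin 1) ℝ)
  have h2 := measurePreserving_sub_prod (volume : Measure ℝ) (volume : Measure ℝ)
  have h3 := (volume_preserving_finTwoArrow ℝ).symm
  convert! h3.comp (h2.comp h1) using 1

/-- Inversion for the slices x_0 + x_1 = t of the unit square: the central slice, parametrised by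
x_1, has length 1. The shear replaces orthonormal coordinates since (1, 1) is not a unit vector. -/
lemma integral_sinc_sq :
    ∫ s in Set.Ioi 0, s ^ 0 * ∏ k : Fin 2, Real.sinc ((fun _ => 1 : Fin 2 → ℝ) k * s) =
      Real.pi / 2 := by
  have hF := isRadialPair_sinc_cos.eq_integral_of_fourier (V := ℝ) (by simp)
    (a := (fun _ => 1 : Fin 2 → ℝ)) (i := 0) (j := 1) (by simp) one_ne_zero one_ne_zero Real.pi_pos
    (integrable_slice shear (1 / 2)) (continuousAt_slice_zero shear (1 / 2) (by norm_num))
    (fun w => by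
      rw [integral_slice_smul_eq_prod shear (1 / 2) measurePreserving_shear (fun _ => 1)
        (fun t y => by simp [shear_apply]) (fun t => (Real.fourierChar (-inner ℝ t w) : ℂ))
        (by fun_prop) (by simp)
        (fun s t => by rw [inner_add_left, neg_add, AddChar.map_add_eq_mul, Circle.coe_mul])]
      simp only [integral_closedBall_fourierChar_real]
      push_cast
      rfl)
  have hs : slice shear (1 / 2) 0 = 1 := by
    have : {y : Fin 1 → ℝ | shear (0, y) ∈ box ℝ 2 (1 / 2)} =
        Set.univ.pi fun _ => Metric.closedBall 0 (1 / 2) := by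
      ext y
      simp [box, shear_apply, Fin.forall_fin_two]
    rw [slice, this, Measure.real, volume_pi_pi]
    simp
  rw [hs] at hF
  have hv : (volume : Measure ℝ).real (Metric.ball 0 1) = 2 := by simp [Measure.real]
  rw [hv] at hF
  have := Real.pi_pos
  generalize (∫ s in Set.Ioi 0, s ^ 0 * ∏ k : Fin 2, Real.sinc ((fun _ => 1 : Fin 2 → ℝ) k * s)) = I
    at hF ⊢
  field_simp at hF ⊢
  push_cast at hF
  linarith

/-- The Dirichlet integral. -/
lemma tendsto_integral_sinc :
    Tendsto (fun T : ℝ => ∫ s in (0 : ℝ)..T, Real.sinc s) atTop (𝓝 (Real.pi / 2)) := by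
  -- For a = (1, 1) both integrands are sinc s cos s = sinc 2s, so the summation identity evaluates
  -- ∫ sinc over [0, 2T] from ∫ sinc².
  have h := isRadialPair_sinc_cos.tendsto_sum_integral (fun _ => 1 : Fin 2 → ℝ)
    (i := 0) (j := 1) (by simp) one_ne_zero one_ne_zero
  rw [integral_sinc_sq] at h
  have h2 : ∀ T : ℝ, ∑ k : Fin 2, ∫ s in (0 : ℝ)..T,
      radialIntegrand 0 Real.sinc Real.cos (fun _ => 1 : Fin 2 → ℝ) k s =
      ∫ s in (0 : ℝ)..(2 * T), Real.sinc s := by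
    intro T
    have h3 : ∀ k s, radialIntegrand 0 Real.sinc Real.cos (fun _ => 1 : Fin 2 → ℝ) k s =
        Real.sinc (2 * s) := by
      intro k s
      have h4 : ∏ j ∈ Finset.univ.erase k, Real.sinc (1 * s) = Real.sinc s := by
        rw [Finset.prod_const, Finset.card_erase_of_mem (Finset.mem_univ k)]
        simp
      rw [radialIntegrand, h4]
      rcases eq_or_ne s 0 with rfl | hs
      · simp
      · rw [Real.sinc_of_ne_zero hs, Real.sinc_of_ne_zero (by simpa using hs), Real.sin_two_mul]
        simp
        field_simp
    simp only [h3, Finset.sum_const, Finset.card_univ, Fintype.card_fin, nsmul_eq_mul]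
    rw [intervalIntegral.integral_comp_mul_left _ two_ne_zero]
    simp
  simp only [h2] at h
  have h5 := h.comp (tendsto_id.atTop_div_const (two_pos : (0 : ℝ) < 2))
  norm_num at h5
  refine h5.congr fun T => ?_
  simp [mul_div_cancel₀]

/-- s j_1(s) = 2 J_1(s) = -2 J_0'(s), and J_0 tends to 0. -/
lemma tendsto_integral_besselj1_mul :
    Tendsto (fun T : ℝ => ∫ s in (0 : ℝ)..T, besselj1 s * s) atTop (𝓝 2) := by
  have h1 : ∀ T : ℝ, ∫ s in (0 : ℝ)..T, besselj1 s * s = 2 - 2 * besselJ 0 T := by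
    intro T
    have hc := continuous_besselj1
    rw [intervalIntegral.integral_eq_sub_of_hasDerivAt (f := fun s => -2 * besselJ 0 s)
      (fun s _ => ?_) ((by fun_prop : Continuous _).intervalIntegrable _ _)]
    · rw [besselJ_zero_zero]; ring
    · refine ((hasDerivAt_besselJ_zero s).const_mul (-2)).congr_deriv ?_
      linarith [mul_besselj1 s]
  simp only [h1]
  have h2 := (tendsto_besselJ_zero_mul one_ne_zero).const_mul 2
  simp only [one_mul, mul_zero] at h2
  simpa using h2.const_sub 2

/-! ### Summation in the two cases, Ball's formula, conclusion -/

open Classical in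
lemma IsRadialPair.sum_ite_of_two {d n : ℕ} {u v : ℝ → ℝ} (h : IsRadialPair d u v)
    (a : Fin n → ℝ) {i j : Fin n} (hij : i ≠ j) (hai : a i ≠ 0) (haj : a j ≠ 0) (c : ℝ) :
    (∑ k, if ∃ j, j ≠ k ∧ a j ≠ 0 then c * improperIntegral (radialIntegrand d u v a k) else 0) =
      ((n : ℝ) - 1) * (c * ∫ s in Set.Ioi 0, s ^ d * ∏ t, u (a t * s)) := by
  have h1 : ∀ k, ∃ j, j ≠ k ∧ a j ≠ 0 := fun k => by
    by_cases hik : i = k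
    · exact ⟨j, fun hjk => hij (hik.trans hjk.symm), haj⟩
    · exact ⟨i, hik, hai⟩
  simp only [h1, if_true]
  rw [← Finset.mul_sum, h.sum_improperIntegral a hij hai haj]
  ring

-- For a = ±e_i the term k = i is 0 by convention, and each other term is c times the integral of
-- u(s) s^d, that is c l = 1.
open Classical in
lemma IsRadialPair.sum_ite_of_single {d n : ℕ} {u v : ℝ → ℝ} (h : IsRadialPair d u v)
    (a : Fin n → ℝ) {i : Fin n} (hi : |a i| = 1) (ha : ∀ j, j ≠ i → a j = 0) {c l : ℝ}
    (hl : Tendsto (fun T : ℝ => ∫ s in (0 : ℝ)..T, u s * s ^ d) atTop (𝓝 l)) (hc : c * l = 1) :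
    (∑ k, if ∃ j, j ≠ k ∧ a j ≠ 0 then c * improperIntegral (radialIntegrand d u v a k) else 0) =
      (n : ℝ) - 1 := by
  have hai : a i ≠ 0 := fun h0 => by simp [h0] at hi
  have h1 : ∀ k, (if ∃ j, j ≠ k ∧ a j ≠ 0 then
      c * improperIntegral (radialIntegrand d u v a k) else 0) = 1 - if k = i then 1 else 0 := by
    intro k
    by_cases hk : k = i
    · subst hk
      rw [if_neg]
      · simp
      · rintro ⟨j, hj, haj⟩
        exact haj (ha j hj)
    · rw [if_pos ⟨i, fun h => hk h.symm, hai⟩, if_neg hk, sub_zero]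
      have h2 : radialIntegrand d u v a k = fun s => u s * s ^ d := by
        ext s
        have h3 : u (a i * s) = u s := by
          rcases abs_choice (a i) with h4 | h4 <;> rw [h4] at hi
          · rw [hi, one_mul]
          · rw [← h.left_neg, ← neg_mul, hi, one_mul]
        rw [radialIntegrand, ha k hk, zero_mul, h.right_zero, mul_one,
          Finset.prod_eq_single_of_mem i (by simpa using Ne.symm hk), h3]
        intro j _ hj
        rw [ha j hj, zero_mul, h.left_zero]
      rw [h2, improperIntegral, hl.limUnder_eq, hc]
  simp only [h1, Finset.sum_sub_distrib, Finset.sum_ite_eq', Finset.mem_univ, if_true]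
  simp

lemma integrandReal_eq {n : ℕ} (a : EuclideanSpace ℝ (Fin n)) (k : Fin n) :
    integrandReal a k = radialIntegrand 0 Real.sinc Real.cos a.ofLp k := by
  ext s
  simp [integrandReal, radialIntegrand]

lemma integrandComplex_eq {n : ℕ} (a : EuclideanSpace ℝ (Fin n)) (k : Fin n) :
    integrandComplex a k = radialIntegrand 1 besselj1 (besselJ 0) a.ofLp k := by
  ext s
  simp [integrandComplex, radialIntegrand]

/-- Ball's formula for the volume of a central section of the cube. -/
lemma sectionReal_eq {m : ℕ} (a : EuclideanSpace ℝ (Fin (m + 1))) (ha : ‖a‖ = 1)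
    {i j : Fin (m + 1)} (hij : i ≠ j) (hai : a i ≠ 0) (haj : a j ≠ 0) :
    sectionReal a =
      2 / Real.pi * ∫ s in Set.Ioi 0, s ^ 0 * ∏ k, Real.sinc (a k * s) := by
  obtain ⟨L, hL, hLa, hsec⟩ := exists_coordinates (𝕜 := ℝ) (d := 1)
    (fun m => by rw [one_mul]; exact measurePreserving_ofLp_real m) a ha
  have hF := isRadialPair_sinc_cos.eq_integral_of_fourier (V := ℝ) (by simp)
    (a := a.ofLp) hij hai haj Real.pi_pos
    (integrable_slice L (1 / 2)) (continuousAt_slice_zero L (1 / 2) (by norm_num))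
    (fun w => by
      rw [integral_slice_smul_eq_prod L (1 / 2) hL a.ofLp
        (fun t y => by simpa using hLa t y) (fun t => (Real.fourierChar (-inner ℝ t w) : ℂ))
        (by fun_prop) (by simp)
        (fun s t => by rw [inner_add_left, neg_add, AddChar.map_add_eq_mul, Circle.coe_mul])]
      simp only [integral_closedBall_fourierChar_real]
      push_cast
      rfl)
  have hv : (volume : Measure ℝ).real (Metric.ball 0 1) = 2 := by simp [Measure.real]
  rw [hv, ← hsec, one_mul] at hF
  rw [sectionReal, Nat.add_sub_cancel, hF]
  norm_num

/-- The complex analogue of Ball's formula, for the polydisc. -/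
lemma sectionComplex_eq {m : ℕ} (a : EuclideanSpace ℝ (Fin (m + 1))) (ha : ‖a‖ = 1)
    {i j : Fin (m + 1)} (hij : i ≠ j) (hai : a i ≠ 0) (haj : a j ≠ 0) :
    sectionComplex (toComplex a) =
      1 / 2 * ∫ s in Set.Ioi 0, s ^ 1 * ∏ k, besselj1 (a k * s) := by
  have ha' : ‖toComplex a‖ = 1 := by
    rw [← ha]
    simp [EuclideanSpace.norm_eq, toComplex]
  have hα : 0 < 1 / Real.sqrt Real.pi := by positivity
  obtain ⟨L, hL, hLa, hsec⟩ := exists_coordinates (𝕜 := ℂ) (d := 2)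
    measurePreserving_ofLp_complex (toComplex a) ha'
  have hF := isRadialPair_besselj1_besselJ_zero.eq_integral_of_fourier (V := ℂ) (by simp)
    (a := a.ofLp) hij hai haj (κ := 2 * Real.sqrt Real.pi) (by positivity)
    (integrable_slice L (1 / Real.sqrt Real.pi)) (continuousAt_slice_zero L _ hα)
    (fun w => by
      rw [integral_slice_smul_eq_prod L _ hL (fun k => (a k : ℂ))
        (fun t y => by simpa [toComplex] using hLa t y)
        (fun t => (Real.fourierChar (-inner ℝ t w) : ℂ))
        (by fun_prop) (by simp)
        (fun s t => by rw [inner_add_left, neg_add, AddChar.map_add_eq_mul, Circle.coe_mul])]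
      simp only [integral_closedBall_fourierChar_complex]
      push_cast
      rfl)
  have hv : (volume : Measure ℂ).real (Metric.ball 0 1) = Real.pi := by simp [Measure.real]
  rw [hv, ← hsec] at hF
  -- The constant is 2π/(2√π)² = 1/2.
  rw [sectionComplex, Nat.add_sub_cancel, hF, mul_pow, Real.sq_sqrt Real.pi_pos.le]
  have := Real.pi_pos.ne'
  congr 1
  push_cast
  field_simp
  norm_num

theorem proposition3 (n : ℕ) (a : EuclideanSpace ℝ (Fin n)) (ha : ‖a‖ = 1) :
    ((∀ k, (∃ j, j ≠ k ∧ a j ≠ 0) → ImproperConverges (integrandReal a k)) ∧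
      ∑ k, DReal a k = ((n : ℝ) - 1) * sectionReal a) ∧
    ((∀ k, (∃ j, j ≠ k ∧ a j ≠ 0) → ImproperConverges (integrandComplex a k)) ∧
      ∑ k, DComplex a k = ((n : ℝ) - 1) * sectionComplex (toComplex a)) := by
  classical
  have hr := isRadialPair_sinc_cos
  have hc := isRadialPair_besselj1_besselJ_zero
  simp only [DReal, DComplex, integrandReal_eq, integrandComplex_eq]
  suffices h : (∑ k, if ∃ j, j ≠ k ∧ a j ≠ 0 then 2 / Real.pi *
      improperIntegral (radialIntegrand 0 Real.sinc Real.cos a.ofLp k) else 0) =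
        ((n : ℝ) - 1) * sectionReal a ∧
      (∑ k, if ∃ j, j ≠ k ∧ a j ≠ 0 then 1 / 2 *
        improperIntegral (radialIntegrand 1 besselj1 (besselJ 0) a.ofLp k) else 0) =
        ((n : ℝ) - 1) * sectionComplex (toComplex a) by
    refine ⟨⟨fun k hk => hr.improperConverges _ hk, ?_⟩, fun k hk => hc.improperConverges _ hk, ?_⟩
    · convert h.1
    · convert h.2
  obtain ⟨i, hai⟩ : ∃ i, a i ≠ 0 := by
    by_contra! h0
    rw [show a = 0 from PiLp.ext h0, norm_zero] at ha
    exact zero_ne_one ha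
  obtain _ | m := n
  · exact i.elim0
  by_cases hex : ∃ j, i ≠ j ∧ a j ≠ 0
  · obtain ⟨j, hij, haj⟩ := hex
    rw [sectionReal_eq a ha hij hai haj, sectionComplex_eq a ha hij hai haj]
    exact ⟨hr.sum_ite_of_two a.ofLp hij hai haj _, hc.sum_ite_of_two a.ofLp hij hai haj _⟩
  -- Here a = ±e_i. The product has a single nonconstant factor and `integrableOn_prod` does not
  -- apply, so both sides are computed directly.
  · push Not at hex
    have ha0 : ∀ j, j ≠ i → a j = 0 := fun j hj => hex j hj.symm
    have hi : |a i| = 1 := by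
      rw [EuclideanSpace.norm_eq, Finset.sum_eq_single i (fun j _ hj => by simp [ha0 j hj])
        (by simp), Real.sqrt_sq (norm_nonneg _)] at ha
      exact ha
    have h1 : sectionReal a = 1 := by
      have h2 := real_cube_inter_coordinate (𝕜 := ℝ) (d := 1)
        (fun m => by rw [one_mul]; exact measurePreserving_ofLp_real m) a hai ha0
        (α := 1 / 2) (by norm_num)
      rw [one_mul] at h2
      rw [sectionReal, Nat.add_sub_cancel, h2]
      simp [Measure.real]
    have h2 : sectionComplex (toComplex a) = 1 := by
      have h3 := real_cube_inter_coordinate (𝕜 := ℂ) (d := 2) measurePreserving_ofLp_complex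
        (toComplex a) (k := i) (by simpa [toComplex] using hai)
        (fun j hj => by simp [toComplex, ha0 j hj]) (α := 1 / Real.sqrt Real.pi) (by positivity)
      rw [sectionComplex, Nat.add_sub_cancel, h3]
      have h4 : (volume : Measure ℂ).real (Metric.closedBall 0 (1 / Real.sqrt Real.pi)) = 1 := by
        rw [Measure.real, Complex.volume_closedBall, ENNReal.toReal_mul, ENNReal.toReal_pow,
          ENNReal.toReal_ofReal (by positivity), div_pow, Real.sq_sqrt Real.pi_pos.le]
        have := Real.pi_pos.ne'
        simp [this]
      rw [h4, one_pow]
    rw [h1, h2, mul_one]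
    refine ⟨hr.sum_ite_of_single a.ofLp hi ha0 (l := Real.pi / 2) ?_ ?_,
      hc.sum_ite_of_single a.ofLp hi ha0 (l := 2) ?_ (by norm_num)⟩
    · simpa using tendsto_integral_sinc
    · have := Real.pi_pos.ne'
      field_simp
    · simpa using tendsto_integral_besselj1_mul
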